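/- For complex numbers $s,t,r$ let $$M_{s,t,r}=\partial\bar\partial-s\,z\,\partial-t\,\bar z\,\bar\partial-r,\qquad \partial=\tfrac12(\partial_x-i\partial_y),\quad \bar\partial=\tfrac12(\partial_x+i\partial_y),$$ let $(x,y)_k=x(x+y)\cdots(x+(k-1)y)$, $(x,y)_0=1$, $(x)_k=(x,1)_k$, and put $$\mathcal P(\alpha,\beta|\gamma;z)=\sum_{k=0}^{\infty}\frac{(\alpha,\beta)_k}{(\gamma)_k}\frac{z^k}{k!}.$$ Let $u$ be a complex-valued $C^2$ function on the open unit disc $\mathbb D$ with $M_{s,t,r}u=0$ in $\mathbb D$. Then $u\in C^\infty(\mathbb D)$ and $$u(z)=\sum_{m=0}^{\infty}\frac{\partial^m u(0)}{m!}\,\mathcal P(r+sm,s+t\,|\,m+1;|z|^2)\,z^m+\sum_{m=1}^{\infty}\frac{\bar\partial^m u(0)}{m!}\,\mathcal P(r+tm,t+s\,|\,m+1;|z|^2)\,\bar z^m,\qquad z\in\mathbb D.$$ Both series converge absolutely at every point of $\mathbb D$, and absolutely in $C^\infty(\mathbb D)$: writing $u_m$ for the term of index $m$ in either series, $\sum_m\sup_{K}|\partial^j\bar\partial^k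 u_m|<\infty$ for all $j,k\ge 0$ and all compact $K\subset\mathbb D$. In particular, if $s=t=0$ (the Helmholtz equation $\partial\bar\partial u-ru=0$), then for $z\in\mathbb D$ $$u(z)=\sum_{m=1}^{\infty}\sum_{n=0}^{\infty}\frac{z^m\partial^m u(0)+\bar z^m\bar\partial^m u(0)}{(m+n)!}\,\frac{r^n|z|^{2n}}{n!}+\sum_{n=0}^{\infty}\frac{u(0)}{n!}\frac{r^n|z|^{2n}}{n!},$$ with an absolutely convergent double series and an absolutely convergent single series, and if $s=t=r=0$ (the Laplace equation), then for $z\in\mathbb D$ $$u(z)=\sum_{m=1}^{\infty}\frac{z^m\partial^m u(0)+\bar z^m\bar\partial^m u(0)}{m!}+u(0),$$ with an absolutely convergent series. -/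

import Mathlib

open scoped ContDiff Nat ComplexConjugate

noncomputable section

namespace GenHarmonic

/-- The open unit disc of the complex plane. -/
def disc : Set ℂ := Metric.ball 0 1

/-- The complex derivative `∂ = (∂/∂x - i ∂/∂y) / 2`. -/
def dz (f : ℂ → ℂ) (z : ℂ) : ℂ :=
  (fderiv ℝ f z 1 - Complex.I * fderiv ℝ f z Complex.I) / 2

/-- The complex derivative `∂̄ = (∂/∂x + i ∂/∂y) / 2`. -/
def dzbar (f : ℂ → ℂ) (z : ℂ) : ℂ :=
  (fderiv ℝ f z 1 + Complex.I * fderiv ℝ f z Complex.I) / 2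

/-- The operator `M_{s,t,r} = ∂∂̄ - s z ∂ - t z̄ ∂̄ - r`. -/
def M (s t r : ℂ) (u : ℂ → ℂ) (z : ℂ) : ℂ :=
  dz (dzbar u) z - s * z * dz u z - t * conj z * dzbar u z - r * u z

/-- `u` is a solution on the unit disc: it is of class `C²` there and `M_{s,t,r} u = 0`. -/
structure IsSolution (s t r : ℂ) (u : ℂ → ℂ) : Prop where
  contDiffOn : ContDiffOn ℝ 2 u disc
  eq_zero : ∀ z ∈ disc, M s t r u z = 0

/-- The generalised Pochhammer symbol `(x, y)_n = x (x + y) ⋯ (x + (n - 1) y)`. -/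
def poch (x y : ℂ) (n : ℕ) : ℂ := ∏ i ∈ Finset.range n, (x + i * y)

/-- `𝒫(α, β | γ; z) = ∑ k, (α, β)_k / (γ)_k * z ^ k / k!`, where `(γ)_k = (γ, 1)_k`.
It is used for `γ = 1, 2, 3, …`, where the series converges absolutely for all `z`. -/
def P (α β γ z : ℂ) : ℂ := ∑' k : ℕ, poch α β k / poch γ 1 k * (z ^ k / (k ! : ℂ))

/-- The term of weight `m` of the expansion of `u`. -/
def holTerm (s t r : ℂ) (u : ℂ → ℂ) (m : ℕ) (z : ℂ) : ℂ :=
  (dz^[m] u 0) / (m ! : ℂ) * P (r + s * m) (s + t) (m + 1) ((‖z‖ ^ 2 : ℝ) : ℂ) * z ^ m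

/-- The term of weight `-m` of the expansion of `u`. -/
def antiholTerm (s t r : ℂ) (u : ℂ → ℂ) (m : ℕ) (z : ℂ) : ℂ :=
  (dzbar^[m] u 0) / (m ! : ℂ) * P (r + t * m) (t + s) (m + 1) ((‖z‖ ^ 2 : ℝ) : ℂ)
    * (conj z) ^ m

/-- The seminorm `‖f‖_{j,k,K} = sup_K |∂^j ∂̄^k f|`. For `K` running over the compact subsets of
the disc these define the topology of `C^∞` of the disc. -/
def seminormOn (j k : ℕ) (K : Set ℂ) (f : ℂ → ℂ) : ℝ :=
  sSup ((fun z => ‖dz^[j] (dzbar^[k] f) z‖) '' K)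

end GenHarmonic

end

noncomputable section

namespace GenHarmonic

open Set Filter
open scoped Topology

section

/-! ### Power series in `z` and `conj z` -/

/-! The operator commutes with rotations, so the Fourier modes of `u` on the circles |z| = ρ
decouple. The m-th coefficient f of `u` and the (m+1)-st coefficient b of ∂̄u solve a first-order
radial system (`IsSolution.radialSystem`), which needs only one derivative of `u` and one of ∂̄u.
For m ≥ 0 this system is singular at ρ = 0, and by a Wronskian argument its solutions bounded near 0
are multiples of one of them (`RadialSystem.exists_eq_mul`). The recurrence `coef_succ` shows that
ρ^m 𝒫(r+sm, s+t | m+1; ρ²) is such a solution, so the m-th coefficient is c_m times it. Negative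
modes reduce to nonnegative ones through u(z̄), which solves the equation with s and t exchanged.

For convergence, the Fourier coefficients on a circle of radius R < 1 are bounded uniformly in m,
while 𝒫(r+sm, s+t | m+1; x) tends to e^{sx} ≠ 0 as m → ∞ (`tendsto_P_atTop`). Hence c_m = O(R^{-m})
for every R < 1. The Taylor coefficients of 𝒫 are at most C^k/k! with C independent of m, so all the
modes together form a power series in z and z̄ that converges absolutely in the disc
(`convDisc_mul_coef`). Such series can be differentiated termwise indefinitely, which gives
smoothness and absolute convergence in C^∞. The Fourier series now converges absolutely on each
circle and sums to `u`; applying ∂^m and ∂̄^m at 0 identifies the constants. -/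

/-- The series `∑ i, a i * z ^ α i * conj z ^ β i`. -/
def biseries {ι : Type*} (a : ι → ℂ) (α β : ι → ℕ) (z : ℂ) : ℂ :=
  ∑' i, a i * z ^ α i * conj z ^ β i

/-- The series `biseries a α β` converges absolutely in the open unit disc. -/
def ConvDisc {ι : Type*} (a : ι → ℂ) (α β : ι → ℕ) : Prop :=
  ∀ R : ℝ, 0 < R → R < 1 → Summable fun i => ‖a i‖ * R ^ (α i + β i)

variable {ι : Type*} {a : ι → ℂ} {α β : ι → ℕ}

lemma isOpen_disc : IsOpen disc := Metric.isOpen_ball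

lemma mem_disc {z : ℂ} : z ∈ disc ↔ ‖z‖ < 1 := by simp [disc]

lemma norm_monomial_le {z : ℂ} {R : ℝ} (hz : ‖z‖ ≤ R) (c : ℂ) (j k : ℕ) :
    ‖c * z ^ j * conj z ^ k‖ ≤ ‖c‖ * R ^ (j + k) := by
  rw [norm_mul, norm_mul, norm_pow, norm_pow, Complex.norm_conj, mul_assoc, ← pow_add]
  gcongr

lemma ConvDisc.summable_norm (h : ConvDisc a α β) {z : ℂ} (hz : z ∈ disc) :
    Summable fun i => ‖a i * z ^ α i * conj z ^ β i‖ := by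
  obtain ⟨R, hzR, hR⟩ := exists_between (mem_disc.1 hz)
  exact Summable.of_nonneg_of_le (fun _ => norm_nonneg _)
    (fun i => norm_monomial_le hzR.le _ _ _) (h R ((norm_nonneg _).trans_lt hzR) hR)

lemma ConvDisc.summable (h : ConvDisc a α β) {z : ℂ} (hz : z ∈ disc) :
    Summable fun i => a i * z ^ α i * conj z ^ β i := (h.summable_norm hz).of_norm

lemma ConvDisc.swap (h : ConvDisc a α β) : ConvDisc a β α := fun R h0 h1 => by
  simpa only [add_comm] using h R h0 h1

/-- The sequence n (R/R')^n tends to 0, hence is bounded: a slightly larger radius absorbs the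
factor n produced by differentiation. -/
lemma exists_nat_mul_pow_pred_le {R R' : ℝ} (h0 : 0 < R) (h : R < R') :
    ∃ C : ℝ, ∀ n : ℕ, n * R ^ (n - 1) ≤ C * R' ^ n := by
  have hR' : 0 < R' := h0.trans h
  have hlim := tendsto_self_mul_const_pow_of_lt_one (r := R / R') (by positivity)
    ((div_lt_one hR').2 h)
  obtain ⟨B, hB⟩ := hlim.bddAbove_range
  refine ⟨B / R, fun n => ?_⟩
  have h1 : n * (R / R') ^ n ≤ B := hB ⟨n, rfl⟩
  rcases n with _ | n
  · simp only [Nat.cast_zero, zero_mul] at h1 ⊢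
    positivity
  · have h2 : ((n + 1 : ℕ) : ℝ) * R ^ (n + 1) ≤ B * R' ^ (n + 1) := by
      rw [div_pow, mul_div_assoc', div_le_iff₀ (by positivity)] at h1
      exact h1
    rw [div_mul_eq_mul_div, le_div_iff₀ h0, Nat.add_sub_cancel, mul_assoc, ← pow_succ]
    exact h2

/-- The factor `α i` is paid for by passing from R to some R' in (R, 1). Truncation of `α i - 1` at
`α i = 0` is harmless, as the coefficient is then 0. -/
lemma ConvDisc.deriv_left (h : ConvDisc a α β) :
    ConvDisc (fun i => α i * a i) (fun i => α i - 1) β := by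
  intro R h0 h1
  obtain ⟨R', hR, hR'⟩ := exists_between h1
  obtain ⟨C, hC⟩ := exists_nat_mul_pow_pred_le h0 hR
  refine Summable.of_nonneg_of_le (fun _ => by positivity) (fun i => ?_)
    ((h R' (h0.trans hR) hR').mul_left C)
  calc ‖(α i : ℂ) * a i‖ * R ^ (α i - 1 + β i)
      = ‖a i‖ * (α i * R ^ (α i - 1)) * R ^ β i := by
        rw [norm_mul, Complex.norm_natCast, pow_add]; ring
    _ ≤ ‖a i‖ * (C * R' ^ α i) * R' ^ β i := by
        have := hC (α i)
        have h3 : 0 ≤ (α i : ℝ) * R ^ (α i - 1) := by positivity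
        have h4 := mul_nonneg (norm_nonneg (a i)) (h3.trans this)
        gcongr
    _ = C * (‖a i‖ * R' ^ (α i + β i)) := by rw [pow_add]; ring

lemma ConvDisc.deriv_right (h : ConvDisc a α β) :
    ConvDisc (fun i => β i * a i) α (fun i => β i - 1) := h.swap.deriv_left.swap

/-- The real-linear map `w ↦ p * w + q * conj w`. -/
def wirtingerCLM (p q : ℂ) : ℂ →L[ℝ] ℂ :=
  p • (ContinuousLinearMap.id ℝ ℂ) + q • (Complex.conjCLE : ℂ →L[ℝ] ℂ)

@[simp] lemma wirtingerCLM_apply (p q w : ℂ) : wirtingerCLM p q w = p * w + q * conj w := by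
  simp [wirtingerCLM]

lemma norm_wirtingerCLM_le (p q : ℂ) : ‖wirtingerCLM p q‖ ≤ ‖p‖ + ‖q‖ := by
  refine ContinuousLinearMap.opNorm_le_bound _ (by positivity) fun w => ?_
  rw [wirtingerCLM_apply]
  refine (norm_add_le _ _).trans ?_
  simp [add_mul]

lemma wirtingerCLM_eq_add (p q : ℂ) :
    wirtingerCLM p q = p • (ContinuousLinearMap.id ℝ ℂ) + q • (Complex.conjCLE : ℂ →L[ℝ] ℂ) := rfl

lemma hasFDerivAt_monomial (c : ℂ) (j k : ℕ) (z : ℂ) :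
    HasFDerivAt (𝕜 := ℝ) (fun z : ℂ => c * z ^ j * conj z ^ k)
      (wirtingerCLM (j * c * z ^ (j - 1) * conj z ^ k) (k * c * z ^ j * conj z ^ (k - 1))) z := by
  have h1 : HasFDerivAt (𝕜 := ℝ) (fun z : ℂ => z ^ j)
      ((j * z ^ (j - 1)) • (ContinuousLinearMap.id ℝ ℂ)) z := by
    have := (hasDerivAt_pow j z).hasFDerivAt.restrictScalars ℝ
    convert! this using 1
    ext
    simp [mul_comm]
  have h2 : HasFDerivAt (𝕜 := ℝ) (fun z : ℂ => conj z ^ k)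
      ((k * conj z ^ (k - 1)) • (Complex.conjCLE : ℂ →L[ℝ] ℂ)) z := by
    have := ((hasDerivAt_pow k (conj z)).hasFDerivAt.restrictScalars ℝ).comp z
      (Complex.conjCLE : ℂ →L[ℝ] ℂ).hasFDerivAt
    convert! this using 1
    ext
    simp [mul_comm]
  have := (h1.const_mul c).mul h2
  convert! this using 1
  ext
  simp
  ring

/-- Termwise differentiation: on the ball of radius R < 1 the derivatives of the monomials are
dominated by the two summable derived series. -/
lemma ConvDisc.hasFDerivAt (h : ConvDisc a α β) {z : ℂ} (hz : z ∈ disc) :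
    HasFDerivAt (𝕜 := ℝ) (biseries a α β)
      (wirtingerCLM (biseries (fun i => α i * a i) (fun i => α i - 1) β z)
        (biseries (fun i => β i * a i) α (fun i => β i - 1) z)) z := by
  obtain ⟨R, hzR, hR⟩ := exists_between (mem_disc.1 hz)
  have h0 : 0 < R := (norm_nonneg _).trans_lt hzR
  have key := hasFDerivAt_tsum_of_isPreconnected (𝕜 := ℝ)
    (f := fun i z => a i * z ^ α i * conj z ^ β i) (s := Metric.ball (0 : ℂ) R) (x₀ := z) (x := z)
    ((h.deriv_left R h0 hR).add (h.deriv_right R h0 hR)) Metric.isOpen_ball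
    (convex_ball _ _).isPreconnected (fun i w _ => hasFDerivAt_monomial (a i) (α i) (β i) w)
    (fun i w hw => (norm_wirtingerCLM_le _ _).trans (by
      have hw' : ‖w‖ ≤ R := (mem_ball_zero_iff.1 hw).le
      exact add_le_add (norm_monomial_le hw' _ _ _) (norm_monomial_le hw' _ _ _)))
    (by simpa using hzR) (h.summable hz) (by simpa using hzR)
  convert! key using 1
  have s1 := h.deriv_left.summable hz
  have s2 := h.deriv_right.summable hz
  simp only [wirtingerCLM_eq_add]
  rw [Summable.tsum_add (s1.smul_const _) (s2.smul_const _), s1.tsum_smul_const,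
    s2.tsum_smul_const]
  rfl

/-! ### Wirtinger derivatives and their iterates on biseries -/

lemma dz_eq_of_hasFDerivAt {f : ℂ → ℂ} {p q z : ℂ} (h : HasFDerivAt f (wirtingerCLM p q) z) :
    dz f z = p := by
  simp only [dz, h.fderiv, wirtingerCLM_apply, map_one, Complex.conj_I]
  linear_combination (-(p - q) / 2) * Complex.I_mul_I

lemma dzbar_eq_of_hasFDerivAt {f : ℂ → ℂ} {p q z : ℂ} (h : HasFDerivAt f (wirtingerCLM p q) z) :
    dzbar f z = q := by
  simp only [dzbar, h.fderiv, wirtingerCLM_apply, map_one, Complex.conj_I]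
  linear_combination ((p - q) / 2) * Complex.I_mul_I

lemma wirtingerCLM_dz_dzbar (f : ℂ → ℂ) (z : ℂ) :
    wirtingerCLM (dz f z) (dzbar f z) = fderiv ℝ f z := by
  apply ContinuousLinearMap.coe_injective
  apply Complex.basisOneI.ext
  intro i
  fin_cases i
  · simp [dz, dzbar]; ring
  · simp only [dz, dzbar, Fin.mk_one, Complex.coe_basisOneI, ContinuousLinearMap.coe_coe,
      wirtingerCLM_apply, Matrix.cons_val_one, Matrix.cons_val_fin_one, Complex.conj_I]
    linear_combination (-(fderiv ℝ f z Complex.I)) * Complex.I_mul_I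

lemma _root_.DifferentiableAt.hasFDerivAt_wirtingerCLM {f : ℂ → ℂ} {z : ℂ}
    (h : DifferentiableAt ℝ f z) : HasFDerivAt f (wirtingerCLM (dz f z) (dzbar f z)) z := by
  rw [wirtingerCLM_dz_dzbar]; exact h.hasFDerivAt

lemma dz_eqOn {f g : ℂ → ℂ} (h : EqOn f g disc) : EqOn (dz f) (dz g) disc := fun z hz => by
  simp only [dz, (h.eventuallyEq_of_mem (isOpen_disc.mem_nhds hz)).fderiv_eq]

lemma dzbar_eqOn {f g : ℂ → ℂ} (h : EqOn f g disc) : EqOn (dzbar f) (dzbar g) disc := fun z hz => by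
  simp only [dzbar, (h.eventuallyEq_of_mem (isOpen_disc.mem_nhds hz)).fderiv_eq]

lemma iterate_dz_eqOn {f g : ℂ → ℂ} (h : EqOn f g disc) (n : ℕ) :
    EqOn (dz^[n] f) (dz^[n] g) disc := by
  induction n with
  | zero => exact h
  | succ n ih => simpa only [Function.iterate_succ_apply'] using dz_eqOn ih

lemma iterate_dzbar_eqOn {f g : ℂ → ℂ} (h : EqOn f g disc) (n : ℕ) :
    EqOn (dzbar^[n] f) (dzbar^[n] g) disc := by
  induction n with
  | zero => exact h
  | succ n ih => simpa only [Function.iterate_succ_apply'] using dzbar_eqOn ih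

lemma ConvDisc.iterate_deriv_left (h : ConvDisc a α β) (n : ℕ) :
    ConvDisc (fun i => (α i).descFactorial n * a i) (fun i => α i - n) β := by
  induction n with
  | zero => simpa using h
  | succ n ih => simpa [Nat.descFactorial_succ, mul_assoc, Nat.sub_sub] using ih.deriv_left

lemma ConvDisc.iterate_deriv_right (h : ConvDisc a α β) (n : ℕ) :
    ConvDisc (fun i => (β i).descFactorial n * a i) α (fun i => β i - n) :=
  (h.swap.iterate_deriv_left n).swap

lemma ConvDisc.iterate_dz (h : ConvDisc a α β) (n : ℕ) :
    EqOn (dz^[n] (biseries a α β))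
      (biseries (fun i => (α i).descFactorial n * a i) (fun i => α i - n) β) disc := by
  induction n with
  | zero => intro z _; simp
  | succ n ih =>
    intro z hz
    rw [Function.iterate_succ_apply', dz_eqOn ih hz,
      dz_eq_of_hasFDerivAt ((h.iterate_deriv_left n).hasFDerivAt hz)]
    simp only [Nat.descFactorial_succ, Nat.cast_mul, mul_assoc, Nat.sub_sub]

lemma ConvDisc.iterate_dzbar (h : ConvDisc a α β) (n : ℕ) :
    EqOn (dzbar^[n] (biseries a α β))
      (biseries (fun i => (β i).descFactorial n * a i) α (fun i => β i - n)) disc := by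
  induction n with
  | zero => intro z _; simp
  | succ n ih =>
    intro z hz
    rw [Function.iterate_succ_apply', dzbar_eqOn ih hz,
      dzbar_eq_of_hasFDerivAt ((h.iterate_deriv_right n).hasFDerivAt hz)]
    simp only [Nat.descFactorial_succ, Nat.cast_mul, mul_assoc, Nat.sub_sub]

/-- The derivative is built from two further biseries with other coefficients and exponents, so the
induction must range over all such data. -/
lemma ConvDisc.contDiffOn_nat (n : ℕ) : ∀ {a : ι → ℂ} {α β : ι → ℕ}, ConvDisc a α β →
    ContDiffOn ℝ n (biseries a α β) disc := by
  induction n with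
  | zero =>
    intro a α β h
    exact contDiffOn_zero.2 fun z hz => (h.hasFDerivAt hz).continuousAt.continuousWithinAt
  | succ n ih =>
    intro a α β h
    push_cast
    refine (contDiffOn_succ_iff_fderiv_of_isOpen isOpen_disc).2
      ⟨fun z hz => (h.hasFDerivAt hz).differentiableAt.differentiableWithinAt, by simp, ?_⟩
    refine ContDiffOn.congr ?_ fun z hz => (h.hasFDerivAt hz).fderiv
    exact ((ih h.deriv_left).smul contDiffOn_const).add ((ih h.deriv_right).smul contDiffOn_const)

lemma ConvDisc.contDiffOn (h : ConvDisc a α β) : ContDiffOn ℝ ∞ (biseries a α β) disc :=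
  contDiffOn_infty.2 fun n => h.contDiffOn_nat n

lemma ConvDisc.continuousOn (h : ConvDisc a α β) : ContinuousOn (biseries a α β) disc :=
  h.contDiffOn.continuousOn

lemma exists_subset_closedBall {K : Set ℂ} (hK : IsCompact K) (hKd : K ⊆ disc) :
    ∃ R : ℝ, 0 < R ∧ R < 1 ∧ ∀ z ∈ K, ‖z‖ ≤ R := by
  rcases K.eq_empty_or_nonempty with rfl | hne
  · exact ⟨1 / 2, by norm_num, by norm_num, by simp⟩
  · obtain ⟨w, hw, hmax⟩ := hK.exists_isMaxOn hne continuous_norm.continuousOn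
    obtain ⟨R, hwR, hR⟩ := exists_between (mem_disc.1 (hKd hw))
    exact ⟨R, (norm_nonneg _).trans_lt hwR, hR, fun z hz => (hmax hz).trans hwR.le⟩

/-- A bound for the seminorms of a biseries by weighted sums of its coefficients. -/
lemma ConvDisc.seminormOn_le (h : ConvDisc a α β) {f : ℂ → ℂ} (hf : EqOn f (biseries a α β) disc)
    {K : Set ℂ} (hKd : K ⊆ disc) {R : ℝ} (h0 : 0 < R) (h1 : R < 1) (hR : ∀ z ∈ K, ‖z‖ ≤ R)
    (j k : ℕ) :
    seminormOn j k K f ≤ ∑' i, ‖((α i).descFactorial j * ((β i).descFactorial k * a i) : ℂ)‖ *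
      R ^ (α i - j + (β i - k)) := by
  have hc := (h.iterate_deriv_right k).iterate_deriv_left j
  -- Nonnegativity of the bound covers empty `K`, where `sSup ∅ = 0`.
  refine Real.sSup_le ?_ (tsum_nonneg fun _ => by positivity)
  rintro _ ⟨z, hz, rfl⟩
  dsimp only
  rw [iterate_dz_eqOn ((iterate_dzbar_eqOn hf k).trans (h.iterate_dzbar k)) j (hKd hz),
    (h.iterate_deriv_right k).iterate_dz j (hKd hz)]
  exact tsum_of_norm_bounded (hc R h0 h1).hasSum fun i => norm_monomial_le (hR z hz) _ _ _

lemma seminormOn_nonneg (j k : ℕ) (K : Set ℂ) (f : ℂ → ℂ) : 0 ≤ seminormOn j k K f :=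
  Real.sSup_nonneg (by rintro _ ⟨z, _, rfl⟩; exact norm_nonneg _)

/-- Grouping a doubly indexed biseries gives absolute convergence in `C^∞`. -/
lemma ConvDisc.summable_seminormOn {κ : Type*} {a : κ × ι → ℂ} {α β : κ × ι → ℕ}
    (h : ConvDisc a α β) {f : κ → ℂ → ℂ}
    (hf : ∀ m, EqOn (f m) (biseries (fun i => a (m, i)) (fun i => α (m, i)) fun i => β (m, i)) disc)
    {K : Set ℂ} (hK : IsCompact K) (hKd : K ⊆ disc) (j k : ℕ) :
    Summable fun m => seminormOn j k K (f m) := by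
  obtain ⟨R, h0, h1, hR⟩ := exists_subset_closedBall hK hKd
  have hm : ∀ m, ConvDisc (fun i => a (m, i)) (fun i => α (m, i)) fun i => β (m, i) :=
    fun m R h0 h1 => (h R h0 h1).prod_factor m
  exact Summable.of_nonneg_of_le (fun _ => seminormOn_nonneg _ _ _ _)
    (fun m => (hm m).seminormOn_le (hf m) hKd h0 h1 hR j k)
    (((h.iterate_deriv_right k).iterate_deriv_left j) R h0 h1).prod

end

section

/-! ### The functions `z ^ m * 𝒫(r + s m, s + t | m + 1; |z|²)` -/

/-- The `k`-th Taylor coefficient of `𝒫(r + s m, s + t | m + 1; ·)`. -/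
def coef (s t r : ℂ) (m k : ℕ) : ℂ := poch (r + s * m) (s + t) k / poch (m + 1) 1 k / (k ! : ℂ)

variable (s t r : ℂ) (m k : ℕ)

@[simp] lemma coef_zero : coef s t r m 0 = 1 := by simp [coef, poch]

lemma poch_succ (x y : ℂ) : poch x y (k + 1) = poch x y k * (x + k * y) :=
  Finset.prod_range_succ _ _

lemma natCast_add_one_add_ne_zero : (m : ℂ) + 1 + k ≠ 0 := by
  exact_mod_cast (by omega : m + 1 + k ≠ 0)

/-- This recurrence is the differential equation read off on coefficients. -/
lemma coef_succ : (k + 1) * (m + 1 + k) * coef s t r m (k + 1) =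
    (r + s * m + k * (s + t)) * coef s t r m k := by
  have h1 := natCast_add_one_add_ne_zero m k
  have h2 : (k : ℂ) + 1 ≠ 0 := by exact_mod_cast k.succ_ne_zero
  simp only [coef, poch_succ, Nat.factorial_succ, Nat.cast_mul, Nat.cast_add, Nat.cast_one, mul_one]
  field_simp

/-- A bound for the growth of the coefficients that does not depend on the weight. -/
def coefBound : ℝ := ‖r‖ + ‖s‖ + ‖s + t‖

lemma coefBound_nonneg : 0 ≤ coefBound s t r := by unfold coefBound; positivity

/-- Factor by factor: 1, m and i are all at most m + 1 + i, so each quotient is bounded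
independently of m and i. -/
lemma norm_poch_div_le : ‖poch (r + s * m) (s + t) k / poch (m + 1) 1 k‖ ≤ coefBound s t r ^ k := by
  rw [poch, poch, ← Finset.prod_div_distrib, norm_prod]
  refine (Finset.prod_le_prod (g := fun _ => coefBound s t r) (fun _ _ => norm_nonneg _)
    fun i _ => ?_).trans (by simp)
  have hn : ‖(m : ℂ) + 1 + i * 1‖ = m + 1 + i := by
    rw [mul_one]; exact_mod_cast Complex.norm_natCast (m + 1 + i)
  rw [norm_div, hn, div_le_iff₀ (by positivity), coefBound]
  calc ‖r + s * m + i * (s + t)‖ ≤ ‖r‖ + ‖s‖ * m + i * ‖s + t‖ := by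
        refine (norm_add₃_le).trans ?_
        simp
    _ ≤ ‖r‖ * (m + 1 + i) + ‖s‖ * (m + 1 + i) + (m + 1 + i) * ‖s + t‖ := by
        have hm : (0 : ℝ) ≤ m := m.cast_nonneg
        have hi : (0 : ℝ) ≤ i := i.cast_nonneg
        gcongr
        · exact le_mul_of_one_le_right (norm_nonneg _) (by linarith)
        · linarith
        · linarith
    _ = _ := by ring

lemma norm_coef_le : ‖coef s t r m k‖ ≤ coefBound s t r ^ k / k ! := by
  rw [coef, norm_div, Complex.norm_natCast]
  gcongr
  exact norm_poch_div_le s t r m k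

lemma P_eq_tsum (x : ℂ) :
    P (r + s * m) (s + t) (m + 1) x = ∑' k, coef s t r m k * x ^ k := by
  rw [P]
  congr 1 with k
  rw [coef]; ring

lemma P_mul_pow (z : ℂ) :
    P (r + s * m) (s + t) (m + 1) ((‖z‖ ^ 2 : ℝ) : ℂ) * z ^ m =
      biseries (coef s t r m) (fun k => m + k) (fun k => k) z := by
  rw [P_eq_tsum, ← tsum_mul_right, biseries]
  congr 1 with k
  push_cast
  rw [← Complex.mul_conj', mul_pow, pow_add]
  ring

lemma P_mul_conj_pow (z : ℂ) :
    P (r + s * m) (s + t) (m + 1) ((‖z‖ ^ 2 : ℝ) : ℂ) * conj z ^ m =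
      biseries (coef s t r m) (fun k => k) (fun k => m + k) z := by
  rw [P_eq_tsum, ← tsum_mul_right, biseries]
  congr 1 with k
  push_cast
  rw [← Complex.mul_conj', mul_pow, pow_add]
  ring

-- Since R^(m+2k) ≤ R^m, the double series is dominated by the product of ∑ |c_m| R^m and an
-- exponential series in k.
variable {s t r} in
lemma convDisc_mul_coef {c : ℕ → ℂ}
    (hc : ∀ R : ℝ, 0 < R → R < 1 → Summable fun m => ‖c m‖ * R ^ m) :
    ConvDisc (fun p : ℕ × ℕ => c p.1 * coef s t r p.1 p.2) (fun p => p.1 + p.2) (fun p => p.2) := by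
  intro R h0 h1
  refine Summable.of_nonneg_of_le (fun _ => by positivity) (fun p => ?_)
    (Summable.mul_of_nonneg (hc R h0 h1) (Real.summable_pow_div_factorial (coefBound s t r))
      (fun _ => by positivity) (fun k => by have := coefBound_nonneg s t r; positivity))
  have h3 : R ^ (p.1 + p.2 + p.2) ≤ R ^ p.1 :=
    pow_le_pow_of_le_one h0.le h1.le (by omega)
  calc ‖c p.1 * coef s t r p.1 p.2‖ * R ^ (p.1 + p.2 + p.2)
      ≤ ‖c p.1‖ * (coefBound s t r ^ p.2 / p.2 !) * R ^ p.1 := by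
        rw [norm_mul]
        have := norm_coef_le s t r p.1 p.2
        have := mul_nonneg (norm_nonneg (c p.1)) ((norm_nonneg _).trans this)
        gcongr
    _ = _ := by ring

lemma convDisc_coef : ConvDisc (coef s t r m) (fun k => m + k) (fun k => k) := by
  have h := convDisc_mul_coef (s := s) (t := t) (r := r) (c := Pi.single m 1) (fun R _ _ =>
    summable_of_ne_finset_zero (s := {m}) fun b hb => by simp_all)
  intro R h0 h1
  simpa using (h R h0 h1).prod_factor m

/-- Each factor (r + sm + i(s+t))/(m+1+i) tends to s, and the bound uniform in m permits dominated
convergence. The nonvanishing limit later bounds 𝒫 away from 0 for large m. -/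
lemma tendsto_P_atTop (x : ℂ) :
    Tendsto (fun m : ℕ => P (r + s * m) (s + t) (m + 1) x) atTop (𝓝 (Complex.exp (s * x))) := by
  have hexp : Complex.exp (s * x) = ∑' k : ℕ, s ^ k / (k ! : ℂ) * x ^ k := by
    rw [Complex.exp_eq_exp_ℂ, NormedSpace.exp_eq_tsum_div]
    refine tsum_congr fun k => ?_
    rw [mul_pow]; ring
  simp only [P_eq_tsum, hexp]
  refine tendsto_tsum_of_dominated_convergence
    (bound := fun k => (coefBound s t r * ‖x‖) ^ k / k !)
    (Real.summable_pow_div_factorial _) (fun k => ?_) (Eventually.of_forall fun m k => ?_)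
  · refine Tendsto.mul_const _ (Tendsto.div_const ?_ _)
    simp only [poch, ← Finset.prod_div_distrib]
    rw [← Finset.card_range k, ← Finset.prod_const, Finset.card_range]
    refine tendsto_finsetProd _ fun i _ => ?_
    have hinv : Tendsto (fun m : ℕ => ((m : ℂ) + 1 + i)⁻¹) atTop (𝓝 0) := by
      have := tendsto_inv_atTop_nhds_zero_nat (𝕜 := ℂ)
      have := this.comp (tendsto_add_atTop_nat (1 + i))
      refine this.congr fun m => ?_
      simp [add_assoc]
    have hlim := (hinv.const_mul (r + i * (s + t) - s * (1 + i))).const_add s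
    rw [mul_zero, add_zero] at hlim
    refine hlim.congr fun m => ?_
    have h1 := natCast_add_one_add_ne_zero m i
    rw [mul_one, eq_div_iff h1, add_mul, inv_mul_cancel_right₀ h1]
    ring
  · rw [norm_mul, norm_pow, mul_pow, mul_div_right_comm]
    gcongr
    exact norm_coef_le s t r m k

/-! ### The radial system -/

/-- The system satisfied on `(0, 1)` by the `m`-th Fourier coefficient `f` of a solution `u` and the
`(m + 1)`-st Fourier coefficient `b` of `∂̄u`. -/
structure RadialSystem (s t r : ℂ) (m : ℕ) (f b : ℝ → ℂ) : Prop where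
  hasDerivAt_fst : ∀ ρ ∈ Ioo (0 : ℝ) 1, HasDerivAt f (m / ρ * f ρ + 2 * b ρ) ρ
  hasDerivAt_snd : ∀ ρ ∈ Ioo (0 : ℝ) 1,
    HasDerivAt b (-((m + 1) / ρ) * b ρ + 2 * (r + s * m) * f ρ + 2 * (s + t) * ρ * b ρ) ρ
  bounded : ∃ B, ∀ ρ ∈ Ioo (0 : ℝ) (1 / 2), ‖f ρ‖ ≤ B ∧ ‖b ρ‖ ≤ B

variable {s t r m}

lemma ofReal_mem_disc {ρ : ℝ} (h0 : 0 < ρ) (h1 : ρ < 1) : (ρ : ℂ) ∈ disc := by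
  rw [mem_disc, Complex.norm_real, Real.norm_of_nonneg h0.le]; exact h1

lemma ConvDisc.exists_bound {ι : Type*} {a : ι → ℂ} {α β : ι → ℕ} (h : ConvDisc a α β) :
    ∃ B, ∀ ρ ∈ Ioo (0 : ℝ) (1 / 2), ‖biseries a α β ρ‖ ≤ B :=
  ⟨_, fun ρ hρ => tsum_of_norm_bounded (h (1 / 2) (by norm_num) (by norm_num)).hasSum fun i =>
    norm_monomial_le (by rw [Complex.norm_real, Real.norm_of_nonneg hρ.1.le]; exact hρ.2.le) _ _ _⟩

lemma ConvDisc.hasDerivAt_ofReal {ι : Type*} {a : ι → ℂ} {α β : ι → ℕ} (h : ConvDisc a α β)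
    {ρ : ℝ} (h0 : 0 < ρ) (h1 : ρ < 1) :
    HasDerivAt (fun ρ : ℝ => biseries a α β ρ)
      (biseries (fun i => α i * a i) (fun i => α i - 1) β ρ +
        biseries (fun i => β i * a i) α (fun i => β i - 1) ρ) ρ := by
  have := (h.hasFDerivAt (ofReal_mem_disc h0 h1)).comp_hasDerivAt ρ
    (Complex.ofRealCLM.hasDerivAt (x := ρ))
  simpa using! this

lemma mul_biseries_deriv_left {ι : Type*} (a : ι → ℂ) (α β : ι → ℕ) (z : ℂ) :
    z * biseries (fun i => α i * a i) (fun i => α i - 1) β z =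
      biseries (fun i => α i * a i) α β z := by
  rw [biseries, biseries, ← tsum_mul_left]
  congr 1 with i
  rcases h : α i with _ | n
  · simp
  · rw [Nat.add_sub_cancel]; ring

lemma mul_biseries_deriv_right {ι : Type*} (a : ι → ℂ) (α β : ι → ℕ) (z : ℂ) :
    conj z * biseries (fun i => β i * a i) α (fun i => β i - 1) z =
      biseries (fun i => β i * a i) α β z := by
  rw [biseries, biseries, ← tsum_mul_left]
  congr 1 with i
  rcases h : β i with _ | n
  · simp
  · rw [Nat.add_sub_cancel]; ring

-- The pair is z^m 𝒫(|z|²) and its ∂̄-derivative, restricted to the positive real axis, where d/dρ =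
-- ∂ + ∂̄.
variable (s t r m) in
lemma radialSystem_coef : RadialSystem s t r m
    (fun ρ : ℝ => biseries (coef s t r m) (fun k => m + k) (fun k => k) ρ)
    (fun ρ : ℝ => biseries (fun k => k * coef s t r m k) (fun k => m + k) (fun k => k - 1) ρ) := by
  have hc := convDisc_coef s t r m
  have hd := hc.deriv_right
  refine ⟨fun ρ hρ => ?_, fun ρ hρ => ?_, ?_⟩
  · have hz := ofReal_mem_disc hρ.1 hρ.2
    have hρ0 : (ρ : ℂ) ≠ 0 := by exact_mod_cast hρ.1.ne'
    convert hc.hasDerivAt_ofReal hρ.1 hρ.2 using 1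
    -- The Euler operators z∂ and z̄∂̄ multiply a term by its exponents, and these differ by m in
    -- every term.
    have e1 := mul_biseries_deriv_left (coef s t r m) (fun k => m + k) (fun k => k) ρ
    have e2 := mul_biseries_deriv_right (coef s t r m) (fun k => m + k) (fun k => k) ρ
    rw [Complex.conj_ofReal] at e2
    have e3 : biseries (fun k => ((m + k : ℕ) : ℂ) * coef s t r m k) (fun k => m + k)
        (fun k => k) ρ = m * biseries (coef s t r m) (fun k => m + k) (fun k => k) ρ +
        biseries (fun k => k * coef s t r m k) (fun k => m + k) (fun k => k) ρ := by
      have s2 := hd.summable hz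
      simp only [biseries]
      rw [← tsum_mul_left, ← Summable.tsum_add ((hc.summable hz).mul_left _) ?_]
      · congr 1 with k
        push_cast; ring
      · refine (s2.mul_left (ρ : ℂ)).congr fun k => ?_
        rcases k with _ | k
        · simp
        · simp only [Nat.add_sub_cancel, Complex.conj_ofReal]; ring
    apply mul_left_cancel₀ hρ0
    rw [mul_add, mul_add, e1, e3, ← e2]
    field_simp
    ring
  · have hz := ofReal_mem_disc hρ.1 hρ.2
    have hρ0 : (ρ : ℂ) ≠ 0 := by exact_mod_cast hρ.1.ne'
    convert hd.hasDerivAt_ofReal hρ.1 hρ.2 using 1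
    set D12 := biseries (fun k => ((m + k : ℕ) : ℂ) * (k * coef s t r m k)) (fun k => m + k - 1)
      (fun k => k - 1) ρ with hD12
    set D22 := biseries (fun k => ((k - 1 : ℕ) : ℂ) * (k * coef s t r m k)) (fun k => m + k)
      (fun k => k - 1 - 1) ρ with hD22
    set g := biseries (coef s t r m) (fun k => m + k) (fun k => k) ρ with hg
    set h := biseries (fun k => k * coef s t r m k) (fun k => m + k) (fun k => k - 1) ρ with hh
    have e1 : ρ * D12 = (m + 1) * h + ρ * D22 := by
      have e2 := mul_biseries_deriv_right (fun k => k * coef s t r m k) (fun k => m + k)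
        (fun k => k - 1) ρ
      rw [Complex.conj_ofReal] at e2
      rw [hD12, mul_biseries_deriv_left (fun k => k * coef s t r m k) (fun k => m + k), hD22, e2,
        hh]
      simp only [biseries]
      rw [← tsum_mul_left, ← Summable.tsum_add ((hd.summable hz).mul_left _) ?_]
      · congr 1 with k
        rcases k with _ | k
        · simp
        · push_cast [Nat.add_sub_cancel]; ring
      · refine (hd.deriv_right.summable hz).mul_left (ρ : ℂ) |>.congr fun k => ?_
        rcases k with _ | _ | k
        · simp
        · simp
        · simp only [Nat.add_sub_cancel, Complex.conj_ofReal]; ring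
    -- This is the equation M = 0 for the mode, with z∂ replaced by m + z̄∂̄. The k = 0 term of
    -- `D12` vanishes, and the shift k ↦ k + 1 turns the identity into `coef_succ`.
    have e4 : D12 = (r + s * m) * g + (s + t) * (ρ * h) := by
      have e2 := mul_biseries_deriv_right (coef s t r m) (fun k => m + k) (fun k => k) ρ
      rw [Complex.conj_ofReal] at e2
      rw [hh, e2, hD12, hg]
      simp only [biseries]
      rw [← tsum_mul_left, ← tsum_mul_left, ← Summable.tsum_add ((hc.summable hz).mul_left _) ?_,
        (hd.deriv_left.summable hz).tsum_eq_zero_add]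
      · simp only [Nat.cast_zero, zero_mul, mul_zero, zero_add]
        congr 1 with k
        have := coef_succ s t r m k
        rw [Nat.add_sub_cancel, ← add_assoc, Nat.add_sub_cancel]
        push_cast
        linear_combination ((ρ : ℂ) ^ (m + k) * conj (ρ : ℂ) ^ k) * this
      · refine ((hd.summable hz).mul_left (ρ : ℂ)).mul_left (s + t) |>.congr fun k => ?_
        rcases k with _ | k
        · simp
        · simp only [Nat.add_sub_cancel, Complex.conj_ofReal]; ring
    apply mul_left_cancel₀ hρ0
    have : (ρ : ℂ) * (-((m + 1) / ρ) * h + 2 * (r + s * m) * g + 2 * (s + t) * ρ * h) =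
        -(m + 1) * h + ρ * (2 * (r + s * m) * g + 2 * (s + t) * ρ * h) := by
      field_simp
      ring
    rw [this]
    linear_combination (-2 * (ρ : ℂ)) * e4 + e1
  · obtain ⟨B, hB⟩ := hc.exists_bound
    obtain ⟨B', hB'⟩ := hd.exists_bound
    exact ⟨max B B', fun ρ hρ => ⟨(hB ρ hρ).trans (le_max_left _ _),
      (hB' ρ hρ).trans (le_max_right _ _)⟩⟩

/-- Divided by ρ^m, the function is continuous at 0 with value 1 there. -/
lemma exists_biseries_coef_ne_zero : ∃ ε : ℝ, 0 < ε ∧ ε < 1 ∧ ∀ ρ ∈ Ioo 0 ε,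
    biseries (coef s t r m) (fun k => m + k) (fun k => k) ((ρ : ℝ) : ℂ) ≠ 0 := by
  have hc : ConvDisc (coef s t r m) (fun k => k) (fun k => k) := fun R h0 h1 => by
    have := (convDisc_coef s t r m R h0 h1).mul_left (R⁻¹ ^ m)
    refine this.congr fun k => ?_
    rw [add_assoc, pow_add R m, inv_pow]
    field_simp
  have h0 : (0 : ℂ) ∈ disc := mem_disc.2 (by simp)
  have hval : biseries (coef s t r m) (fun k => k) (fun k => k) 0 = 1 := by
    rw [biseries, tsum_eq_single 0]
    · simp
    · intro k hk; simp [hk]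
  have hcont :
      ContinuousAt (fun ρ : ℝ => biseries (coef s t r m) (fun k => k) (fun k => k) ρ) 0 := by
    have := hc.continuousOn.continuousAt (isOpen_disc.mem_nhds h0)
    exact ContinuousAt.comp (f := fun ρ : ℝ => (ρ : ℂ))
      (g := biseries (coef s t r m) (fun k => k) (fun k => k)) (by simpa using this)
      Complex.continuous_ofReal.continuousAt
  have hev := hcont.eventually_ne (y := 0) (by simp [hval])
  obtain ⟨ε, hε, hball⟩ := Metric.eventually_nhds_iff.1 hev
  refine ⟨min ε (1 / 2), by positivity, (min_le_right _ _).trans_lt (by norm_num), fun ρ hρ => ?_⟩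
  have h1 := hball (y := ρ) (by
    rw [Real.dist_eq, sub_zero, abs_of_pos hρ.1]; exact hρ.2.trans_le (min_le_left _ _))
  have h2 : biseries (coef s t r m) (fun k => m + k) (fun k => k) (ρ : ℂ) =
      ρ ^ m * biseries (coef s t r m) (fun k => k) (fun k => k) ρ := by
    simp only [biseries]
    rw [← tsum_mul_left]
    congr 1 with k
    ring
  rw [h2]
  exact mul_ne_zero (pow_ne_zero _ (by exact_mod_cast hρ.1.ne')) h1

end

/-! ### Wronskian and uniqueness for the radial system -/

section

variable {s t r : ℂ} {m : ℕ} {f b g h : ℝ → ℂ}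

/-- Abel's identity: the trace of the system is -1/ρ + 2(s+t)ρ, so ρ e^{-(s+t)ρ²} times the
Wronskian is constant. Boundedness of both solutions and the factor ρ force this constant to be 0.
-/
lemma RadialSystem.wronskian_eq_zero (h₁ : RadialSystem s t r m f b)
    (h₂ : RadialSystem s t r m g h) {ρ : ℝ} (hρ : ρ ∈ Ioo (0 : ℝ) 1) : f ρ * h ρ = b ρ * g ρ := by
  set W : ℝ → ℂ := fun ρ =>
    (ρ * (f ρ * h ρ - b ρ * g ρ)) * Complex.exp (-(s + t) * ρ ^ 2) with hW
  have hderiv : ∀ x ∈ Ioo (0 : ℝ) 1, HasDerivAt W 0 x := by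
    intro x hx
    have hx0 : (x : ℂ) ≠ 0 := by exact_mod_cast hx.1.ne'
    have hid : HasDerivAt (fun ρ : ℝ => (ρ : ℂ)) 1 x := by
      simpa using! Complex.ofRealCLM.hasDerivAt (x := x)
    have hexp := ((hid.pow 2).const_mul (-(s + t))).cexp
    have hw := ((h₁.hasDerivAt_fst x hx).mul (h₂.hasDerivAt_snd x hx)).sub
      ((h₁.hasDerivAt_snd x hx).mul (h₂.hasDerivAt_fst x hx))
    convert! (hid.mul hw).mul hexp using 1
    simp only [Pi.mul_apply, Pi.sub_apply, Pi.pow_apply]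
    field_simp
    ring
  have hconst : ∀ x ∈ Ioo (0 : ℝ) 1, W x = W ρ := fun x hx =>
    isOpen_Ioo.is_const_of_deriv_eq_zero isPreconnected_Ioo
      (fun y hy => (hderiv y hy).differentiableAt.differentiableWithinAt)
      (fun y hy => (hderiv y hy).deriv) hx hρ
  have hzero : Tendsto W (𝓝[>] 0) (𝓝 0) := by
    obtain ⟨B₁, hB₁⟩ := h₁.bounded
    obtain ⟨B₂, hB₂⟩ := h₂.bounded
    have hid : Tendsto (fun ρ : ℝ => (ρ : ℂ)) (𝓝[>] 0) (𝓝 0) := by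
      have : Tendsto (fun ρ : ℝ => (ρ : ℂ)) (𝓝 0) (𝓝 ((0 : ℝ) : ℂ)) :=
        Complex.continuous_ofReal.tendsto 0
      rw [Complex.ofReal_zero] at this
      exact this.mono_left nhdsWithin_le_nhds
    have hb : Tendsto (fun ρ : ℝ => (ρ : ℂ) * (f ρ * h ρ - b ρ * g ρ)) (𝓝[>] 0) (𝓝 0) := by
      refine hid.zero_mul_isBoundedUnder_le
        (isBoundedUnder_of_eventually_le (a := 2 * (B₁ * B₂)) ?_)
      filter_upwards [Ioo_mem_nhdsGT (show (0 : ℝ) < 1 / 2 by norm_num)] with x hx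
      have a1 := hB₁ x hx
      have a2 := hB₂ x hx
      calc ‖f x * h x - b x * g x‖ ≤ ‖f x‖ * ‖h x‖ + ‖b x‖ * ‖g x‖ := by
            refine (norm_sub_le _ _).trans ?_
            rw [norm_mul, norm_mul]
        _ ≤ B₁ * B₂ + B₁ * B₂ := by
            have := (norm_nonneg _).trans a1.1
            gcongr
            exacts [a1.1, a2.2, a1.2, a2.1]
        _ = _ := by ring
    have hexp : Tendsto (fun ρ : ℝ => Complex.exp (-(s + t) * ρ ^ 2)) (𝓝[>] 0) (𝓝 1) := by
      have : Tendsto (fun ρ : ℝ => Complex.exp (-(s + t) * ρ ^ 2)) (𝓝 0)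
          (𝓝 (Complex.exp (-(s + t) * ((0 : ℝ) : ℂ) ^ 2))) := by
        apply Continuous.tendsto
        fun_prop
      simpa using this.mono_left nhdsWithin_le_nhds
    simpa only [zero_mul] using hb.mul hexp
  have hlim : Tendsto W (𝓝[>] 0) (𝓝 (W ρ)) := by
    refine tendsto_const_nhds.congr' ?_
    filter_upwards [Ioo_mem_nhdsGT (show (0 : ℝ) < 1 by norm_num)] with x hx
    exact (hconst x hx).symm
  have hWρ : W ρ = 0 := tendsto_nhds_unique hlim hzero
  have hρ0 : (ρ : ℂ) ≠ 0 := by exact_mod_cast hρ.1.ne'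
  simpa [hW, hρ0, Complex.exp_ne_zero, sub_eq_zero] using hWρ

/-- A linear system with bounded coefficients on `[δ, 1)`: solutions with zero data vanish. -/
lemma eqOn_of_radial_derivs {δ : ℝ} (hδ : 0 < δ)
    (hf : ∀ ρ ∈ Ioo (0 : ℝ) 1, HasDerivAt f (m / ρ * f ρ + 2 * b ρ) ρ)
    (hb : ∀ ρ ∈ Ioo (0 : ℝ) 1,
      HasDerivAt b (-((m + 1) / ρ) * b ρ + 2 * (r + s * m) * f ρ + 2 * (s + t) * ρ * b ρ) ρ)
    (hf0 : f δ = 0) (hb0 : b δ = 0) : ∀ ρ ∈ Ico δ 1, f ρ = 0 := by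
  intro ρ hρ
  -- A bound in the sup norm for the coefficient matrix on [δ, ρ], from 1/x ≤ 1/δ and x ≤ 1; a
  -- Grönwall estimate then applies.
  set K : ℝ := (m + 1) / δ + 2 + 2 * ‖r + s * m‖ + 2 * ‖s + t‖ with hK
  have hsub : ∀ x ∈ Icc δ ρ, x ∈ Ioo (0 : ℝ) 1 := fun x hx =>
    ⟨hδ.trans_le hx.1, hx.2.trans_lt hρ.2⟩
  have hX : ∀ x ∈ Icc δ ρ, HasDerivAt (fun x => (f x, b x)) (m / x * f x + 2 * b x,
      -((m + 1) / x) * b x + 2 * (r + s * m) * f x + 2 * (s + t) * x * b x) x :=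
    fun x hx => (hf x (hsub x hx)).prodMk (hb x (hsub x hx))
  have := eq_zero_of_abs_deriv_le_mul_abs_self_of_eq_zero_right (K := K) (a := δ) (b := ρ)
    (f := fun x => (f x, b x)) (f' := fun x : ℝ => (m / x * f x + 2 * b x,
      -((m + 1) / x) * b x + 2 * (r + s * m) * f x + 2 * (s + t) * x * b x))
    (fun x hx => (hX x hx).continuousAt.continuousWithinAt)
    (fun x hx => (hX x (Ico_subset_Icc_self hx)).hasDerivWithinAt) (by simp [hf0, hb0]) ?_ ρ
    ⟨hρ.1, le_rfl⟩
  · exact congrArg Prod.fst this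
  · intro x hx
    have hx' := hsub x (Ico_subset_Icc_self hx)
    set N := ‖(f x, b x)‖ with hN
    have hN0 : 0 ≤ N := norm_nonneg _
    have h1 : ‖f x‖ ≤ N := norm_fst_le (f x, b x)
    have h2 : ‖b x‖ ≤ N := norm_snd_le (f x, b x)
    have hm : ‖(m : ℂ) / x‖ ≤ (m + 1) / δ := by
      rw [norm_div, Complex.norm_natCast, Complex.norm_real, Real.norm_of_nonneg hx'.1.le]
      gcongr
      · linarith
      · exact hx.1
    have hm1 : ‖((m : ℂ) + 1) / x‖ ≤ (m + 1) / δ := by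
      have : ‖(m : ℂ) + 1‖ = m + 1 := by exact_mod_cast Complex.norm_natCast (m + 1)
      rw [norm_div, this, Complex.norm_real, Real.norm_of_nonneg hx'.1.le]
      gcongr
      exact hx.1
    have hxn : ‖(x : ℂ)‖ ≤ 1 := by
      rw [Complex.norm_real, Real.norm_of_nonneg hx'.1.le]; exact hx'.2.le
    have hA : 0 ≤ ((m : ℝ) + 1) / δ := by positivity
    refine max_le ?_ ?_
    · calc ‖(m : ℂ) / x * f x + 2 * b x‖ ≤ ‖(m : ℂ) / x‖ * ‖f x‖ + 2 * ‖b x‖ := by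
            refine (norm_add_le _ _).trans ?_
            simp
        _ ≤ (m + 1) / δ * N + 2 * N := by gcongr
        _ ≤ K * N := by
            rw [hK, ← add_mul]
            refine mul_le_mul_of_nonneg_right ?_ hN0
            linarith [norm_nonneg (r + s * m), norm_nonneg (s + t)]
    · calc ‖-(((m : ℂ) + 1) / x) * b x + 2 * (r + s * m) * f x + 2 * (s + t) * x * b x‖
          ≤ ‖((m : ℂ) + 1) / x‖ * ‖b x‖ + 2 * ‖r + s * m‖ * ‖f x‖ +
            2 * ‖s + t‖ * ‖(x : ℂ)‖ * ‖b x‖ := by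
            refine (norm_add₃_le).trans (le_of_eq ?_)
            simp only [norm_mul, norm_neg, Complex.norm_ofNat]
        _ ≤ (m + 1) / δ * N + 2 * ‖r + s * m‖ * N + 2 * ‖s + t‖ * 1 * N := by gcongr
        _ ≤ K * N := by
            rw [hK]
            nlinarith

/-- Solutions of the radial system that are bounded near the origin form a line. -/
lemma RadialSystem.exists_eq_mul (h₁ : RadialSystem s t r m f b)
    (h₂ : RadialSystem s t r m g h) {ε : ℝ} (hε : 0 < ε) (hε1 : ε < 1)
    (hg : ∀ ρ ∈ Ioo 0 ε, g ρ ≠ 0) : ∃ c : ℂ, ∀ ρ ∈ Ioo (0 : ℝ) 1, f ρ = c * g ρ := by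
  have hδ : ε / 2 ∈ Ioo 0 ε := ⟨by linarith, by linarith⟩
  set c := f (ε / 2) / g (ε / 2) with hc
  have hsub : Ioo 0 ε ⊆ Ioo (0 : ℝ) 1 := Ioo_subset_Ioo_right hε1.le
  -- The numerator of (f/g)' is 2(bg - fh), a multiple of the Wronskian.
  have hquot : ∀ x ∈ Ioo 0 ε, HasDerivAt (fun x => f x / g x) 0 x := by
    intro x hx
    convert! (h₁.hasDerivAt_fst x (hsub hx)).div (h₂.hasDerivAt_fst x (hsub hx)) (hg x hx) using 1
    rw [eq_comm, div_eq_zero_iff]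
    left
    linear_combination (-2) * h₁.wronskian_eq_zero h₂ (hsub hx)
  have hnear : ∀ x ∈ Ioo 0 ε, f x = c * g x := by
    intro x hx
    have : f x / g x = c := isOpen_Ioo.is_const_of_deriv_eq_zero isPreconnected_Ioo
      (fun y hy => (hquot y hy).differentiableAt.differentiableWithinAt)
      (fun y hy => (hquot y hy).deriv) hx hδ
    rw [← this, div_mul_cancel₀ _ (hg x hx)]
  refine ⟨c, fun ρ hρ => ?_⟩
  rcases lt_or_ge ρ (ε / 2) with hlt | hge
  · exact hnear ρ ⟨hρ.1, hlt.trans hδ.2⟩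
  -- Beyond ε/2 the function g may vanish, so the quotient is replaced by uniqueness for the regular
  -- system started at ε/2.
  · refine sub_eq_zero.1 (eqOn_of_radial_derivs (s := s) (t := t) (r := r) (m := m)
      (f := fun ρ => f ρ - c * g ρ) (b := fun ρ => b ρ - c * h ρ) hδ.1 (fun x hx => ?_)
      (fun x hx => ?_) ?_ ?_ ρ ⟨hge, hρ.2⟩)
    · convert! (h₁.hasDerivAt_fst x hx).sub ((h₂.hasDerivAt_fst x hx).const_mul c) using 1
      ring
    · convert! (h₁.hasDerivAt_snd x hx).sub ((h₂.hasDerivAt_snd x hx).const_mul c) using 1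
      ring
    · exact sub_eq_zero.2 (hnear _ hδ)
    -- The vanishing Wronskian and f = cg, with g ≠ 0 at ε/2, give b = ch there.
    · have hw := h₁.wronskian_eq_zero h₂ (hsub hδ)
      rw [hnear _ hδ] at hw
      refine sub_eq_zero.2 (mul_right_cancel₀ (hg _ hδ) ?_)
      linear_combination -hw

end

section

/-! ### Fourier coefficients on circles -/

open Complex in
/-- The `n`-th Fourier coefficient of `v` on the circle of radius `ρ`. -/
def circleCoeff (v : ℂ → ℂ) (n : ℤ) (ρ : ℝ) : ℂ :=
  (2 * Real.pi : ℂ)⁻¹ * ∫ θ in (0 : ℝ)..2 * Real.pi, exp (-(n * θ * I)) * v (ρ * exp (θ * I))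

variable {v w : ℂ → ℂ} {ρ : ℝ}

lemma norm_ofReal_mul_exp (h0 : 0 < ρ) (θ : ℝ) : ‖(ρ : ℂ) * Complex.exp (θ * Complex.I)‖ = ρ := by
  rw [norm_mul, Complex.norm_exp_ofReal_mul_I, mul_one, Complex.norm_real,
    Real.norm_of_nonneg h0.le]

lemma ofReal_mul_exp_mem_disc (h0 : 0 < ρ) (h1 : ρ < 1) (θ : ℝ) :
    (ρ : ℂ) * Complex.exp (θ * Complex.I) ∈ disc := by
  rw [mem_disc, norm_ofReal_mul_exp h0]; exact h1

lemma conj_exp_mul_I (θ : ℝ) :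
    conj (Complex.exp (θ * Complex.I)) = Complex.exp (-(θ * Complex.I)) := by
  rw [← Complex.exp_conj]; simp

lemma continuous_comp_circle (hv : ContinuousOn v disc) (h0 : 0 < ρ) (h1 : ρ < 1) :
    Continuous fun θ : ℝ => v (ρ * Complex.exp (θ * Complex.I)) :=
  hv.comp_continuous (by fun_prop) (ofReal_mul_exp_mem_disc h0 h1)

lemma continuous_integrand (hv : ContinuousOn v disc) (n : ℤ) (h0 : 0 < ρ) (h1 : ρ < 1) :
    Continuous fun θ : ℝ =>
      Complex.exp (-(n * θ * Complex.I)) * v (ρ * Complex.exp (θ * Complex.I)) :=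
  Continuous.mul (by fun_prop) (continuous_comp_circle hv h0 h1)

lemma circleCoeff_congr (h : EqOn v w disc) (n : ℤ) (h0 : 0 < ρ) (h1 : ρ < 1) :
    circleCoeff v n ρ = circleCoeff w n ρ := by
  simp only [circleCoeff, h (ofReal_mul_exp_mem_disc h0 h1 _)]

lemma circleCoeff_add (hv : ContinuousOn v disc) (hw : ContinuousOn w disc) (n : ℤ)
    (h0 : 0 < ρ) (h1 : ρ < 1) :
    circleCoeff (fun z => v z + w z) n ρ = circleCoeff v n ρ + circleCoeff w n ρ := by
  simp only [circleCoeff, mul_add]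
  rw [intervalIntegral.integral_add ((continuous_integrand hv n h0 h1).intervalIntegrable _ _)
    ((continuous_integrand hw n h0 h1).intervalIntegrable _ _), mul_add]

lemma circleCoeff_const_mul (c : ℂ) (v : ℂ → ℂ) (n : ℤ) (ρ : ℝ) :
    circleCoeff (fun z => c * v z) n ρ = c * circleCoeff v n ρ := by
  simp only [circleCoeff, mul_left_comm _ c, intervalIntegral.integral_const_mul]

lemma exp_sub_one_mul (n : ℤ) (θ : ℝ) :
    Complex.exp (-(((n - 1 : ℤ) : ℂ) * θ * Complex.I)) =
      Complex.exp (-(n * θ * Complex.I)) * Complex.exp (θ * Complex.I) := by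
  rw [← Complex.exp_add]; congr 1; push_cast; ring

lemma exp_add_one_mul (n : ℤ) (θ : ℝ) :
    Complex.exp (-(((n + 1 : ℤ) : ℂ) * θ * Complex.I)) =
      Complex.exp (-(n * θ * Complex.I)) * Complex.exp (-(θ * Complex.I)) := by
  rw [← Complex.exp_add]; congr 1; push_cast; ring

lemma norm_exp_neg_int_mul (n : ℤ) (θ : ℝ) : ‖Complex.exp (-(n * θ * Complex.I))‖ = 1 := by
  have : Complex.exp (-(n * θ * Complex.I)) = Complex.exp ((-(n * θ) : ℝ) * Complex.I) := by
    push_cast; ring_nf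
  rw [this, Complex.norm_exp_ofReal_mul_I]

lemma circleCoeff_mul_self (v : ℂ → ℂ) (n : ℤ) (ρ : ℝ) :
    circleCoeff (fun z => z * v z) n ρ = ρ * circleCoeff v (n - 1) ρ := by
  simp only [circleCoeff]
  rw [mul_left_comm (ρ : ℂ), ← intervalIntegral.integral_const_mul (ρ : ℂ)]
  congr 1
  refine intervalIntegral.integral_congr fun θ _ => ?_
  simp only [exp_sub_one_mul]
  ring

lemma circleCoeff_mul_conj (v : ℂ → ℂ) (n : ℤ) (ρ : ℝ) :
    circleCoeff (fun z => conj z * v z) n ρ = ρ * circleCoeff v (n + 1) ρ := by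
  simp only [circleCoeff]
  rw [mul_left_comm (ρ : ℂ), ← intervalIntegral.integral_const_mul (ρ : ℂ)]
  congr 1
  refine intervalIntegral.integral_congr fun θ _ => ?_
  simp only [exp_add_one_mul, map_mul, Complex.conj_ofReal, conj_exp_mul_I]
  ring

lemma exists_norm_le_of_continuousOn {E : Type*} [NormedAddCommGroup E] {v : ℂ → E}
    (hv : ContinuousOn v disc) {R : ℝ} (hR : R < 1) : ∃ B, ∀ z, ‖z‖ ≤ R → ‖v z‖ ≤ B := by
  obtain ⟨B, hB⟩ := (isCompact_closedBall (0 : ℂ) R).exists_bound_of_continuousOn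
    (hv.mono (Metric.closedBall_subset_ball hR))
  exact ⟨B, fun z hz => hB z (by simpa using hz)⟩

lemma exists_norm_circleCoeff_le (hv : ContinuousOn v disc) {R : ℝ} (hR : R < 1) :
    ∃ B, ∀ (n : ℤ), ∀ ρ : ℝ, 0 < ρ → ρ ≤ R → ‖circleCoeff v n ρ‖ ≤ B := by
  obtain ⟨B, hB⟩ := exists_norm_le_of_continuousOn hv hR
  refine ⟨B, fun n ρ h0 h1 => ?_⟩
  have hint := intervalIntegral.norm_integral_le_of_norm_le_const (a := 0) (b := 2 * Real.pi)
    (f := fun θ : ℝ => Complex.exp (-(n * θ * Complex.I)) * v (ρ * Complex.exp (θ * Complex.I)))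
    (C := B) (fun θ _ => by
      rw [norm_mul, norm_exp_neg_int_mul, one_mul]
      exact hB _ (by rwa [norm_ofReal_mul_exp h0]))
  have hpi := Real.pi_pos
  have hn : ‖(2 * Real.pi : ℂ)⁻¹‖ = (2 * Real.pi)⁻¹ := by
    rw [norm_inv]; simp [abs_of_pos hpi]
  rw [sub_zero, abs_of_pos (by positivity)] at hint
  rw [circleCoeff, norm_mul, hn, inv_mul_le_iff₀ (by positivity)]
  linarith

lemma contDiffOn_dz {n : ℕ∞ω} (hv : ContDiffOn ℝ (n + 1) v disc) : ContDiffOn ℝ n (dz v) disc := by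
  have h := ((contDiffOn_succ_iff_fderiv_of_isOpen isOpen_disc).1 hv).2.2
  have h1 := h.clm_apply (contDiffOn_const (c := (1 : ℂ)))
  have hI := h.clm_apply (contDiffOn_const (c := Complex.I))
  exact (h1.sub (contDiffOn_const.mul hI)).div_const 2

lemma contDiffOn_dzbar {n : ℕ∞ω} (hv : ContDiffOn ℝ (n + 1) v disc) :
    ContDiffOn ℝ n (dzbar v) disc := by
  have h := ((contDiffOn_succ_iff_fderiv_of_isOpen isOpen_disc).1 hv).2.2
  have h1 := h.clm_apply (contDiffOn_const (c := (1 : ℂ)))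
  have hI := h.clm_apply (contDiffOn_const (c := Complex.I))
  exact (h1.add (contDiffOn_const.mul hI)).div_const 2

lemma continuousOn_dz (hv : ContDiffOn ℝ 1 v disc) : ContinuousOn (dz v) disc :=
  (contDiffOn_dz (n := 0) (by simpa using hv)).continuousOn

lemma continuousOn_dzbar (hv : ContDiffOn ℝ 1 v disc) : ContinuousOn (dzbar v) disc :=
  (contDiffOn_dzbar (n := 0) (by simpa using hv)).continuousOn

lemma hasFDerivAt_of_contDiffOn (hv : ContDiffOn ℝ 1 v disc) {z : ℂ} (hz : z ∈ disc) :
    HasFDerivAt v (wirtingerCLM (dz v z) (dzbar v z)) z :=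
  ((hv.differentiableOn one_ne_zero).differentiableAt
    (isOpen_disc.mem_nhds hz)).hasFDerivAt_wirtingerCLM

lemma hasDerivAt_radial (hv : ContDiffOn ℝ 1 v disc) (h0 : 0 < ρ) (h1 : ρ < 1) (θ : ℝ) :
    HasDerivAt (fun x : ℝ => v (x * Complex.exp (θ * Complex.I)))
      (dz v (ρ * Complex.exp (θ * Complex.I)) * Complex.exp (θ * Complex.I) +
        dzbar v (ρ * Complex.exp (θ * Complex.I)) * Complex.exp (-(θ * Complex.I))) ρ := by
  have hid : HasDerivAt (fun x : ℝ => (x : ℂ) * Complex.exp (θ * Complex.I))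
      (Complex.exp (θ * Complex.I)) ρ := by
    simpa using! (Complex.ofRealCLM.hasDerivAt (x := ρ)).mul_const (Complex.exp (θ * Complex.I))
  have := (hasFDerivAt_of_contDiffOn hv (ofReal_mul_exp_mem_disc h0 h1 θ)).comp_hasDerivAt ρ hid
  simpa only [wirtingerCLM_apply, conj_exp_mul_I] using! this

lemma hasDerivAt_angular (hv : ContDiffOn ℝ 1 v disc) (h0 : 0 < ρ) (h1 : ρ < 1) (θ : ℝ) :
    HasDerivAt (fun x : ℝ => v (ρ * Complex.exp (x * Complex.I)))
      (Complex.I * ρ * (dz v (ρ * Complex.exp (θ * Complex.I)) * Complex.exp (θ * Complex.I) -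
        dzbar v (ρ * Complex.exp (θ * Complex.I)) * Complex.exp (-(θ * Complex.I)))) θ := by
  have hid : HasDerivAt (fun x : ℝ => (ρ : ℂ) * Complex.exp (x * Complex.I))
      (ρ * (Complex.exp (θ * Complex.I) * Complex.I)) θ := by
    simpa using! (((Complex.ofRealCLM.hasDerivAt (x := θ)).mul_const Complex.I).cexp).const_mul
      (ρ : ℂ)
  have := (hasFDerivAt_of_contDiffOn hv (ofReal_mul_exp_mem_disc h0 h1 θ)).comp_hasDerivAt θ hid
  convert! this using 1
  simp only [wirtingerCLM_apply, map_mul, conj_exp_mul_I, Complex.conj_I, Complex.conj_ofReal]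
  ring

/-- Differentiation under the integral; the factors e^{±iθ} of the radial derivative shift the
indices. -/
lemma hasDerivAt_circleCoeff (hv : ContDiffOn ℝ 1 v disc) (n : ℤ) (h0 : 0 < ρ) (h1 : ρ < 1) :
    HasDerivAt (circleCoeff v n)
      (circleCoeff (dz v) (n - 1) ρ + circleCoeff (dzbar v) (n + 1) ρ) ρ := by
  have hdz := continuousOn_dz hv
  have hdb := continuousOn_dzbar hv
  obtain ⟨R, hρR, hR⟩ := exists_between h1
  obtain ⟨B₁, hB₁⟩ := exists_norm_le_of_continuousOn hdz hR
  obtain ⟨B₂, hB₂⟩ := exists_norm_le_of_continuousOn hdb hR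
  have hs : Ioo 0 R ∈ 𝓝 ρ := Ioo_mem_nhds h0 hρR
  have key := intervalIntegral.hasDerivAt_integral_of_dominated_loc_of_deriv_le
    (μ := MeasureTheory.volume) (a := 0) (b := 2 * Real.pi) (x₀ := ρ) (s := Ioo 0 R)
    (F := fun (x : ℝ) (θ : ℝ) =>
      Complex.exp (-(n * θ * Complex.I)) * v (x * Complex.exp (θ * Complex.I)))
    (F' := fun (x : ℝ) (θ : ℝ) =>
      Complex.exp (-(((n - 1 : ℤ) : ℂ) * θ * Complex.I)) * dz v (x * Complex.exp (θ * Complex.I)) +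
      Complex.exp (-(((n + 1 : ℤ) : ℂ) * θ * Complex.I)) *
        dzbar v (x * Complex.exp (θ * Complex.I)))
    (bound := fun _ => B₁ + B₂) hs
    (by
      filter_upwards [hs] with x hx
      exact (continuous_integrand hv.continuousOn n hx.1 (hx.2.trans hR)).aestronglyMeasurable)
    ((continuous_integrand hv.continuousOn n h0 h1).intervalIntegrable _ _)
    ((continuous_integrand hdz (n - 1) h0 h1).add
      (continuous_integrand hdb (n + 1) h0 h1)).aestronglyMeasurable
    (Eventually.of_forall fun θ _ x hx => by
      have hx' : ‖(x : ℂ) * Complex.exp (θ * Complex.I)‖ ≤ R := by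
        rw [norm_ofReal_mul_exp hx.1]; exact hx.2.le
      refine (norm_add_le _ _).trans ?_
      rw [norm_mul, norm_mul, norm_exp_neg_int_mul, norm_exp_neg_int_mul, one_mul, one_mul]
      exact add_le_add (hB₁ _ hx') (hB₂ _ hx'))
    intervalIntegrable_const
    (Eventually.of_forall fun θ _ x hx => by
      convert! (hasDerivAt_radial hv hx.1 (hx.2.trans hR) θ).const_mul
        (Complex.exp (-(n * θ * Complex.I))) using 1
      rw [exp_sub_one_mul, exp_add_one_mul]
      ring)
  convert! key.2.const_mul (2 * Real.pi : ℂ)⁻¹ using 1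
  rw [intervalIntegral.integral_add ((continuous_integrand hdz _ h0 h1).intervalIntegrable _ _)
    ((continuous_integrand hdb _ h0 h1).intervalIntegrable _ _), mul_add]
  rfl

/-- The θ-derivative of the periodic function e^{-inθ} v(ρe^{iθ}) integrates to 0 over a full turn.
-/
lemma circleCoeff_by_parts (hv : ContDiffOn ℝ 1 v disc) (n : ℤ) (h0 : 0 < ρ) (h1 : ρ < 1) :
    ρ * (circleCoeff (dz v) (n - 1) ρ - circleCoeff (dzbar v) (n + 1) ρ) =
      n * circleCoeff v n ρ := by
  have hdz := continuous_integrand (continuousOn_dz hv) (n - 1) h0 h1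
  have hdb := continuous_integrand (continuousOn_dzbar hv) (n + 1) h0 h1
  have hvc := continuous_integrand hv.continuousOn n h0 h1
  have hd : ∀ θ ∈ uIcc 0 (2 * Real.pi), HasDerivAt
      (fun θ : ℝ => Complex.exp (-(n * θ * Complex.I)) * v (ρ * Complex.exp (θ * Complex.I)))
      (Complex.I * ρ * (Complex.exp (-(((n - 1 : ℤ) : ℂ) * θ * Complex.I)) *
          dz v (ρ * Complex.exp (θ * Complex.I)) -
        Complex.exp (-(((n + 1 : ℤ) : ℂ) * θ * Complex.I)) *
          dzbar v (ρ * Complex.exp (θ * Complex.I))) -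
        Complex.I * n * (Complex.exp (-(n * θ * Complex.I)) *
          v (ρ * Complex.exp (θ * Complex.I)))) θ := by
    intro θ _
    have he : HasDerivAt (fun θ : ℝ => Complex.exp (-(n * θ * Complex.I)))
        (Complex.exp (-(n * θ * Complex.I)) * (-(n * Complex.I))) θ := by
      simpa using!
        ((((Complex.ofRealCLM.hasDerivAt (x := θ)).const_mul (n : ℂ)).mul_const Complex.I).neg).cexp
    convert! he.mul (hasDerivAt_angular hv h0 h1 θ) using 1
    rw [exp_sub_one_mul, exp_add_one_mul]
    ring
  have hc1 : IntervalIntegrable (fun θ : ℝ => Complex.I * ρ *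
      (Complex.exp (-(((n - 1 : ℤ) : ℂ) * θ * Complex.I)) *
          dz v (ρ * Complex.exp (θ * Complex.I)) -
        Complex.exp (-(((n + 1 : ℤ) : ℂ) * θ * Complex.I)) *
          dzbar v (ρ * Complex.exp (θ * Complex.I)))) MeasureTheory.volume 0 (2 * Real.pi) :=
    (continuous_const.mul (hdz.sub hdb)).intervalIntegrable _ _
  have hc2 : IntervalIntegrable (fun θ : ℝ => Complex.I * n *
      (Complex.exp (-(n * θ * Complex.I)) * v (ρ * Complex.exp (θ * Complex.I))))
      MeasureTheory.volume 0 (2 * Real.pi) := (continuous_const.mul hvc).intervalIntegrable _ _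
  have hftc := intervalIntegral.integral_eq_sub_of_hasDerivAt hd (hc1.sub hc2)
  have hend : Complex.exp (-(n * (2 * Real.pi : ℝ) * Complex.I)) = 1 := by
    rw [Complex.exp_eq_one_iff]
    exact ⟨-n, by push_cast; ring⟩
  have hend' : Complex.exp ((2 * Real.pi : ℝ) * Complex.I) = 1 := by
    push_cast; exact Complex.exp_two_pi_mul_I
  rw [intervalIntegral.integral_sub hc1 hc2, intervalIntegral.integral_const_mul,
    intervalIntegral.integral_const_mul,
    intervalIntegral.integral_sub (hdz.intervalIntegrable _ _) (hdb.intervalIntegrable _ _),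
    hend, hend'] at hftc
  simp only [Complex.ofReal_zero, mul_zero, zero_mul, neg_zero, Complex.exp_zero, sub_self] at hftc
  simp only [circleCoeff]
  apply mul_left_cancel₀ Complex.I_ne_zero
  linear_combination (2 * Real.pi : ℂ)⁻¹ * hftc

variable {s t r : ℂ} {u : ℂ → ℂ}

/-- Radial differentiation gives the sum of the coefficients of ∂ and ∂̄, integration by parts their
difference. Together they eliminate ∂u from the first equation; in the second, ∂∂̄u is replaced by
means of M u = 0. -/
lemma IsSolution.radialSystem (hu : IsSolution s t r u) (m : ℕ) :
    RadialSystem s t r m (circleCoeff u m) (circleCoeff (dzbar u) (m + 1)) := by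
  have hu1 : ContDiffOn ℝ 1 u disc := hu.contDiffOn.of_le one_le_two
  have hb1 : ContDiffOn ℝ 1 (dzbar u) disc :=
    contDiffOn_dzbar (n := 1) (by simpa [one_add_one_eq_two] using hu.contDiffOn)
  have hdz := continuousOn_dz hu1
  have hdb := continuousOn_dzbar hu1
  refine ⟨fun ρ hρ => ?_, fun ρ hρ => ?_, ?_⟩
  · have hρ0 : (ρ : ℂ) ≠ 0 := by exact_mod_cast hρ.1.ne'
    convert! hasDerivAt_circleCoeff hu1 m hρ.1 hρ.2 using 1
    have := circleCoeff_by_parts hu1 m hρ.1 hρ.2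
    push_cast at this
    field_simp
    linear_combination -this
  · have hρ0 : (ρ : ℂ) ≠ 0 := by exact_mod_cast hρ.1.ne'
    convert! hasDerivAt_circleCoeff hb1 (m + 1) hρ.1 hρ.2 using 1
    have e1 := circleCoeff_by_parts hu1 m hρ.1 hρ.2
    have e2 := circleCoeff_by_parts hb1 (m + 1) hρ.1 hρ.2
    -- The m-th Fourier coefficient of M u = 0; multiplication by z or z̄ shifts the index.
    have e3 : circleCoeff (dz (dzbar u)) m ρ = s * (ρ * circleCoeff (dz u) (m - 1) ρ) +
        t * (ρ * circleCoeff (dzbar u) (m + 1) ρ) + r * circleCoeff u m ρ := by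
      have hc1 : ContinuousOn (fun z => s * (z * dz u z)) disc := by fun_prop
      have hc2 : ContinuousOn (fun z => t * (conj z * dzbar u z)) disc :=
        continuousOn_const.mul (Complex.continuous_conj.continuousOn.mul hdb)
      have hc3 : ContinuousOn (fun z => r * u z) disc := continuousOn_const.mul hu1.continuousOn
      have hc12 : ContinuousOn (fun z => s * (z * dz u z) + t * (conj z * dzbar u z)) disc :=
        hc1.add hc2
      rw [← circleCoeff_mul_self, ← circleCoeff_mul_conj, ← circleCoeff_const_mul,
        ← circleCoeff_const_mul, ← circleCoeff_const_mul, ← circleCoeff_add hc1 hc2 _ hρ.1 hρ.2,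
        ← circleCoeff_add hc12 hc3 _ hρ.1 hρ.2]
      refine circleCoeff_congr (fun z hz => ?_) _ hρ.1 hρ.2
      have := hu.eq_zero z hz
      rw [M] at this
      linear_combination this
    rw [add_sub_cancel_right] at e2 ⊢
    push_cast at e1 e2
    rw [e3] at e2 ⊢
    field_simp
    linear_combination e2 - 2 * ρ * s * e1
  · obtain ⟨B₁, h₁⟩ := exists_norm_circleCoeff_le hu1.continuousOn (R := 1 / 2) (by norm_num)
    obtain ⟨B₂, h₂⟩ := exists_norm_circleCoeff_le hdb (R := 1 / 2) (by norm_num)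
    exact ⟨max B₁ B₂, fun ρ hρ => ⟨(h₁ _ ρ hρ.1 hρ.2.le).trans (le_max_left _ _),
      (h₂ _ ρ hρ.1 hρ.2.le).trans (le_max_right _ _)⟩⟩

end

section

variable {s t r : ℂ} {u v : ℂ → ℂ}

/-! ### Reflection in the real axis -/

lemma conj_mem_disc {z : ℂ} (hz : z ∈ disc) : conj z ∈ disc := by
  rw [mem_disc] at hz ⊢; rwa [Complex.norm_conj]

lemma hasFDerivAt_comp_conj (hv : ContDiffOn ℝ 1 v disc) {z : ℂ} (hz : z ∈ disc) :
    HasFDerivAt (fun z => v (conj z)) (wirtingerCLM (dzbar v (conj z)) (dz v (conj z))) z := by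
  have := (hasFDerivAt_of_contDiffOn hv (conj_mem_disc hz)).comp z
    (Complex.conjCLE : ℂ →L[ℝ] ℂ).hasFDerivAt
  convert! this using 1
  ext
  simp [add_comm]

lemma dz_comp_conj (hv : ContDiffOn ℝ 1 v disc) :
    EqOn (dz fun z => v (conj z)) (fun z => dzbar v (conj z)) disc := fun _ hz =>
  dz_eq_of_hasFDerivAt (hasFDerivAt_comp_conj hv hz)

lemma dzbar_comp_conj (hv : ContDiffOn ℝ 1 v disc) :
    EqOn (dzbar fun z => v (conj z)) (fun z => dz v (conj z)) disc := fun _ hz =>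
  dzbar_eq_of_hasFDerivAt (hasFDerivAt_comp_conj hv hz)

lemma dz_dzbar_comm (hv : ContDiffOn ℝ 2 v disc) {z : ℂ} (hz : z ∈ disc) :
    dz (dzbar v) z = dzbar (dz v) z := by
  have hat : ContDiffAt ℝ 2 v z := hv.contDiffAt (isOpen_disc.mem_nhds hz)
  have hsymm : fderiv ℝ (fderiv ℝ v) z 1 Complex.I = fderiv ℝ (fderiv ℝ v) z Complex.I 1 :=
    hat.isSymmSndFDerivAt (by simp) 1 Complex.I
  have hd : HasFDerivAt (fderiv ℝ v) (fderiv ℝ (fderiv ℝ v) z) z :=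
    ((hat.fderiv_right (m := 1) (by norm_num [one_add_one_eq_two])).differentiableAt
      one_ne_zero).hasFDerivAt
  have h1 := hd.clm_apply (hasFDerivAt_const (1 : ℂ) z)
  have hI := (hd.clm_apply (hasFDerivAt_const Complex.I z)).const_mul Complex.I
  have hb : HasFDerivAt (dzbar v) _ z := (h1.add hI).mul_const (2⁻¹ : ℂ)
  have hz : HasFDerivAt (dz v) _ z := (h1.sub hI).mul_const (2⁻¹ : ℂ)
  rw [dz, dzbar, hb.fderiv, hz.fderiv]
  simp
  rw [hsymm]
  ring

/-- Conjugation interchanges ∂ and ∂̄, hence s and t; the order of the mixed derivative is restored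
by `dz_dzbar_comm`. -/
lemma IsSolution.comp_conj (hu : IsSolution s t r u) :
    IsSolution t s r fun z => u (conj z) := by
  have hu1 : ContDiffOn ℝ 1 u disc := hu.contDiffOn.of_le one_le_two
  have hz1 : ContDiffOn ℝ 1 (dz u) disc :=
    contDiffOn_dz (n := 1) (by simpa [one_add_one_eq_two] using hu.contDiffOn)
  refine ⟨hu.contDiffOn.comp (Complex.conjCLE : ℂ →L[ℝ] ℂ).contDiff.contDiffOn
    fun z hz => conj_mem_disc hz, fun z hz => ?_⟩
  have h := hu.eq_zero (conj z) (conj_mem_disc hz)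
  rw [M, Complex.conj_conj] at h
  rw [M, dz_eqOn (dzbar_comp_conj hu1) hz, dz_comp_conj hz1 hz, dz_comp_conj hu1 hz,
    dzbar_comp_conj hu1 hz]
  dsimp only
  rw [← dz_dzbar_comm hu.contDiffOn (conj_mem_disc hz)]
  linear_combination h

lemma circleCoeff_comp_conj (v : ℂ → ℂ) (n : ℤ) (ρ : ℝ) :
    circleCoeff (fun z => v (conj z)) n ρ = circleCoeff v (-n) ρ := by
  have h := intervalIntegral.integral_comp_sub_left (a := 0) (b := 2 * Real.pi)
    (fun θ : ℝ => Complex.exp (-(((-n : ℤ) : ℂ) * θ * Complex.I)) *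
      v (ρ * Complex.exp (θ * Complex.I))) (2 * Real.pi)
  rw [sub_self, sub_zero] at h
  simp only [circleCoeff]
  rw [← h]
  congr 1
  refine intervalIntegral.integral_congr fun θ _ => ?_
  have h1 : Complex.exp (-(((-n : ℤ) : ℂ) * ((2 * Real.pi - θ : ℝ) : ℂ) * Complex.I)) =
      Complex.exp (-(n * θ * Complex.I)) := by
    rw [Complex.exp_eq_exp_iff_exists_int]
    exact ⟨n, by push_cast; ring⟩
  have h2 : Complex.exp (((2 * Real.pi - θ : ℝ) : ℂ) * Complex.I) =
      Complex.exp (-(θ * Complex.I)) := by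
    rw [Complex.exp_eq_exp_iff_exists_int]
    exact ⟨1, by push_cast; ring⟩
  simp only [h1, h2, map_mul, Complex.conj_ofReal, conj_exp_mul_I]

/-! ### The expansion of a solution -/

/-- The Fourier coefficients of nonnegative index of a solution. -/
lemma IsSolution.exists_coeff (hu : IsSolution s t r u) : ∃ c : ℕ → ℂ,
    (∀ m : ℕ, ∀ ρ : ℝ, 0 < ρ → ρ < 1 → circleCoeff u m ρ =
      c m * biseries (coef s t r m) (fun k => m + k) (fun k => k) ρ) ∧
    ∀ R : ℝ, 0 < R → R < 1 → Summable fun m => ‖c m‖ * R ^ m := by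
  have hex : ∀ m : ℕ, ∃ c : ℂ, ∀ ρ ∈ Ioo (0 : ℝ) 1, circleCoeff u m ρ =
      c * biseries (coef s t r m) (fun k => m + k) (fun k => k) ρ := by
    intro m
    obtain ⟨ε, h0, h1, hne⟩ := exists_biseries_coef_ne_zero (s := s) (t := t) (r := r) (m := m)
    exact (hu.radialSystem m).exists_eq_mul (radialSystem_coef s t r m) h0 h1 hne
  choose c hc using hex
  refine ⟨c, fun m ρ h0 h1 => hc m ρ ⟨h0, h1⟩, fun R h0 h1 => ?_⟩
  obtain ⟨R', hR, hR'⟩ := exists_between h1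
  have h0' : 0 < R' := h0.trans hR
  obtain ⟨B, hB⟩ := exists_norm_circleCoeff_le hu.contDiffOn.continuousOn hR'
  set x : ℂ := ((R' ^ 2 : ℝ) : ℂ) with hx
  set δ : ℝ := ‖Complex.exp (s * x)‖ / 2 with hδ
  have hE : 0 < ‖Complex.exp (s * x)‖ := norm_pos_iff.2 (Complex.exp_ne_zero _)
  have hδ0 : 0 < δ := half_pos hE
  -- For large m, |𝒫| at R'² exceeds δ, half the modulus of its limit; the uniform bound B on the
  -- circle of radius R' then yields |c_m| ≤ B/(δ R'^m).
  have hev := (tendsto_P_atTop s t r x).norm.eventually (lt_mem_nhds (half_lt_self hE))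
  refine Summable.of_norm_bounded_eventually_nat (g := fun m => B / δ * (R / R') ^ m)
    ((summable_geometric_of_lt_one (by positivity) ((div_lt_one h0').2 hR)).mul_left _) ?_
  filter_upwards [hev] with m hm
  have h2 : ‖c m‖ * (δ * R' ^ m) ≤ B := by
    have h3 := hB m R' h0' le_rfl
    rw [hc m R' ⟨h0', hR'⟩, ← P_mul_pow, norm_mul, norm_mul, norm_pow, Complex.norm_real,
      Real.norm_of_nonneg h0'.le] at h3
    refine le_trans ?_ h3
    gcongr
  rw [Real.norm_of_nonneg (by positivity), div_pow, div_mul_div_comm, le_div_iff₀ (by positivity)]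
  calc ‖c m‖ * R ^ m * (δ * R' ^ m) = (‖c m‖ * (δ * R' ^ m)) * R ^ m := by ring
    _ ≤ B * R ^ m := by gcongr

lemma biseries_const_mul {ι : Type*} (c : ℂ) (a : ι → ℂ) (α β : ι → ℕ) (z : ℂ) :
    biseries (fun i => c * a i) α β z = c * biseries a α β z := by
  rw [biseries, biseries, ← tsum_mul_left]
  simp only [mul_assoc]

/-- On each circle a function is the sum of its Fourier series, if that is absolutely
convergent. -/
lemma hasSum_circleCoeff (hv : ContinuousOn v disc) {ρ : ℝ} (h0 : 0 < ρ) (h1 : ρ < 1)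
    (hs : Summable fun n : ℤ => circleCoeff v n ρ) (θ : ℝ) :
    HasSum (fun n : ℤ => circleCoeff v n ρ * Complex.exp (n * θ * Complex.I))
      (v (ρ * Complex.exp (θ * Complex.I))) := by
  have hpi := Real.pi_pos
  have : Fact (0 < 2 * Real.pi) := ⟨by positivity⟩
  have hexp : ∀ θ : ℝ, ((AddCircle.toCircle (θ : AddCircle (2 * Real.pi)) : Circle) : ℂ) =
      Complex.exp (θ * Complex.I) := fun θ => by
    rw [AddCircle.toCircle_apply_mk, Circle.coe_exp, div_self (by positivity), one_mul]
  have hcont : Continuous fun x : AddCircle (2 * Real.pi) =>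
      v (ρ * (AddCircle.toCircle x : ℂ)) := by
    refine hv.comp_continuous (continuous_const.mul
      (continuous_subtype_val.comp AddCircle.continuous_toCircle)) fun x => ?_
    rw [mem_disc, norm_mul, Circle.norm_coe, mul_one, Complex.norm_real,
      Real.norm_of_nonneg h0.le]
    exact h1
  have hfour : ∀ (n : ℤ) (θ : ℝ), fourier n (θ : AddCircle (2 * Real.pi)) =
      Complex.exp (n * θ * Complex.I) := fun n θ => by
    rw [fourier_coe_apply]
    congr 1
    have : (Real.pi : ℂ) ≠ 0 := by exact_mod_cast hpi.ne'
    push_cast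
    field_simp
  have hcoeff : ∀ n : ℤ, fourierCoeff (fun x : AddCircle (2 * Real.pi) =>
      v (ρ * (AddCircle.toCircle x : ℂ))) n = circleCoeff v n ρ := by
    intro n
    rw [fourierCoeff_eq_intervalIntegral _ n 0, zero_add, circleCoeff, Complex.real_smul]
    congr 1
    · push_cast; rw [one_div]
    · refine intervalIntegral.integral_congr fun θ _ => ?_
      simp only [hfour, hexp, smul_eq_mul]
      push_cast
      ring_nf
  have := has_pointwise_sum_fourier_series_of_summable
    (f := (⟨_, hcont⟩ : C(AddCircle (2 * Real.pi), ℂ))) (hs.congr fun n => (hcoeff n).symm)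
    (θ : AddCircle (2 * Real.pi))
  simpa only [hcoeff, hfour, smul_eq_mul, ContinuousMap.coe_mk, hexp] using this

end

/-! ### Assembling the modes and identifying the coefficients -/

variable {s t r : ℂ} {u : ℂ → ℂ}

section Grouping

variable {κ ι : Type*} {a : κ × ι → ℂ} {α β : κ × ι → ℕ}

lemma ConvDisc.hasSum_grouped (h : ConvDisc a α β) {z : ℂ} (hz : z ∈ disc) :
    HasSum (fun m => biseries (fun i => a (m, i)) (fun i => α (m, i)) (fun i => β (m, i)) z)
      (biseries a α β z) :=
  (h.summable hz).hasSum.prod_fiberwise fun m => ((h.summable hz).prod_factor m).hasSum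

end Grouping

lemma ConvDisc.sumElim {ι κ : Type*} {a : ι → ℂ} {α β : ι → ℕ} {a' : κ → ℂ} {α' β' : κ → ℕ}
    (h : ConvDisc a α β) (h' : ConvDisc a' α' β') :
    ConvDisc (Sum.elim a a') (Sum.elim α α') (Sum.elim β β') := fun R h0 h1 =>
  Summable.sum _ (h R h0 h1) (h' R h0 h1)

lemma biseries_sumElim {ι κ : Type*} {a : ι → ℂ} {α β : ι → ℕ} {a' : κ → ℂ} {α' β' : κ → ℕ}
    (h : ConvDisc a α β) (h' : ConvDisc a' α' β') {z : ℂ} (hz : z ∈ disc) :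
    biseries (Sum.elim a a') (Sum.elim α α') (Sum.elim β β') z =
      biseries a α β z + biseries a' α' β' z :=
  Summable.tsum_sum (f := fun i => Sum.elim a a' i * z ^ Sum.elim α α' i * conj z ^ Sum.elim β β' i)
    (h.summable hz) (h'.summable hz)

/-- 𝒫 sees only |z|, so a rotation acts through z^m alone. -/
lemma biseries_coef_rotate (m : ℕ) (ρ θ : ℝ) :
    biseries (coef s t r m) (fun k => m + k) (fun k => k) ρ * Complex.exp (m * θ * Complex.I) =
      biseries (coef s t r m) (fun k => m + k) (fun k => k) (ρ * Complex.exp (θ * Complex.I)) := by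
  rw [← P_mul_pow, ← P_mul_pow, norm_mul, Complex.norm_exp_ofReal_mul_I, mul_one, mul_pow,
    ← Complex.exp_nat_mul, mul_assoc (m : ℂ), mul_assoc]

lemma biseries_coef_rotate_neg (m : ℕ) (ρ θ : ℝ) :
    biseries (coef s t r m) (fun k => m + k) (fun k => k) ρ * Complex.exp (-(m * θ * Complex.I)) =
      biseries (coef s t r m) (fun k => k) (fun k => m + k) (ρ * Complex.exp (θ * Complex.I)) := by
  rw [← P_mul_pow, ← P_mul_conj_pow, norm_mul, Complex.norm_exp_ofReal_mul_I, mul_one, map_mul,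
    conj_exp_mul_I, Complex.conj_ofReal, mul_pow, ← Complex.exp_nat_mul, mul_neg,
    mul_assoc (m : ℂ), mul_assoc]

/-- The expansion of a solution into terms of fixed weight, with as yet unidentified
coefficients. -/
lemma IsSolution.exists_expansion (hu : IsSolution s t r u) : ∃ c d : ℕ → ℂ,
    ConvDisc (fun p : ℕ × ℕ => c p.1 * coef s t r p.1 p.2) (fun p => p.1 + p.2) (fun p => p.2) ∧
    ConvDisc (fun p : ℕ × ℕ => d (p.1 + 1) * coef t s r (p.1 + 1) p.2) (fun p => p.2)
      (fun p => p.1 + 1 + p.2) ∧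
    EqOn u (fun z =>
      biseries (fun p : ℕ × ℕ => c p.1 * coef s t r p.1 p.2) (fun p => p.1 + p.2) (fun p => p.2) z +
      biseries (fun p : ℕ × ℕ => d (p.1 + 1) * coef t s r (p.1 + 1) p.2) (fun p => p.2)
        (fun p => p.1 + 1 + p.2) z) disc := by
  obtain ⟨c, hc, hcs⟩ := hu.exists_coeff
  obtain ⟨d, hd, hds⟩ := hu.comp_conj.exists_coeff
  have hC := convDisc_mul_coef (s := s) (t := t) (r := r) hcs
  have hD : ConvDisc (fun p : ℕ × ℕ => d (p.1 + 1) * coef t s r (p.1 + 1) p.2) (fun p => p.2)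
      (fun p => p.1 + 1 + p.2) := by
    refine ConvDisc.swap fun R h0 h1 => ?_
    exact (convDisc_mul_coef (s := t) (t := s) (r := r) hds R h0 h1).comp_injective
      (i := fun p : ℕ × ℕ => (p.1 + 1, p.2)) fun p q h => by
        simpa [Prod.ext_iff] using h
  refine ⟨c, d, hC, hD, ?_⟩
  have hucont := hu.contDiffOn.continuousOn
  have hoff : ∀ z ∈ disc, z ≠ 0 → u z = biseries (fun p : ℕ × ℕ => c p.1 * coef s t r p.1 p.2)
        (fun p => p.1 + p.2) (fun p => p.2) z +
      biseries (fun p : ℕ × ℕ => d (p.1 + 1) * coef t s r (p.1 + 1) p.2) (fun p => p.2)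
        (fun p => p.1 + 1 + p.2) z := by
    intro z hz hz0
    have h0 : 0 < ‖z‖ := norm_pos_iff.2 hz0
    have h1 : ‖z‖ < 1 := mem_disc.1 hz
    have hpolar : (‖z‖ : ℂ) * Complex.exp (Complex.arg z * Complex.I) = z :=
      Complex.norm_mul_exp_arg_mul_I z
    have hneg : ∀ n : ℕ, circleCoeff u (-((n : ℤ) + 1)) ‖z‖ = d (n + 1) *
        biseries (coef t s r (n + 1)) (fun k => n + 1 + k) (fun k => k) ‖z‖ := by
      intro n
      rw [← hd (n + 1) ‖z‖ h0 h1, circleCoeff_comp_conj]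
      push_cast
      rfl
    have hsC := hC.hasSum_grouped hz
    have hsD := hD.hasSum_grouped hz
    simp only [biseries_const_mul] at hsC hsD
    have hposval : ∀ n : ℕ, circleCoeff u n ‖z‖ * Complex.exp (((n : ℤ) : ℂ) * z.arg * Complex.I) =
        c n * biseries (coef s t r n) (fun k => n + k) (fun k => k) z := by
      intro n
      rw [hc n ‖z‖ h0 h1, mul_assoc, Int.cast_natCast, biseries_coef_rotate, hpolar]
    have hnegval : ∀ n : ℕ, circleCoeff u (-((n : ℤ) + 1)) ‖z‖ *
        Complex.exp (((-((n : ℤ) + 1) : ℤ) : ℂ) * z.arg * Complex.I) =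
        d (n + 1) * biseries (coef t s r (n + 1)) (fun k => k) (fun k => n + 1 + k) z := by
      intro n
      have := biseries_coef_rotate_neg (s := t) (t := s) (r := r) (n + 1) ‖z‖ z.arg
      rw [hpolar] at this
      rw [hneg, mul_assoc, ← this]
      push_cast
      ring_nf
    have hsum : HasSum (fun n : ℤ => circleCoeff u n ‖z‖ * Complex.exp (n * z.arg * Complex.I)) _ :=
      HasSum.of_nat_of_neg_add_one (by simpa only [hposval] using hsC)
        (by simpa only [hnegval] using hsD)
    -- The exponentials have modulus 1, so summability of the modes at z passes to the Fourier
    -- coefficients.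
    have hsummable : Summable fun n : ℤ => circleCoeff u n ‖z‖ := by
      refine Summable.of_norm (hsum.summable.norm.congr fun n => ?_)
      have : Complex.exp (n * z.arg * Complex.I) = Complex.exp ((n * z.arg : ℝ) * Complex.I) := by
        push_cast; rfl
      rw [norm_mul, this, Complex.norm_exp_ofReal_mul_I, mul_one]
    have := (hasSum_circleCoeff hucont h0 h1 hsummable z.arg).unique hsum
    rwa [hpolar] at this
  intro z hz
  by_cases hz0 : z = 0
  -- The polar argument needs a positive radius; at the origin both sides agree by continuity.
  · subst hz0
    have hnhds : disc ∈ 𝓝 (0 : ℂ) := isOpen_disc.mem_nhds hz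
    have h1 : Tendsto u (𝓝[≠] 0) (𝓝 (u 0)) :=
      (hucont.continuousAt hnhds).mono_left nhdsWithin_le_nhds
    have h2 := ((hC.continuousOn.add hD.continuousOn).continuousAt hnhds).mono_left
      (nhdsWithin_le_nhds (s := {0}ᶜ))
    refine tendsto_nhds_unique h1 (h2.congr' ?_)
    filter_upwards [nhdsWithin_le_nhds hnhds, self_mem_nhdsWithin] with w hw hw0
    exact (hoff w hw hw0).symm
  · exact hoff z hz hz0

/-- After differentiation several indices can have both exponents truncated to 0; the hypothesis
asks that all but one carry a zero coefficient. -/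
lemma biseries_zero_eq_single {ι : Type*} {a : ι → ℂ} {α β : ι → ℕ} (i : ι)
    (h : ∀ j ≠ i, α j = 0 → β j = 0 → a j = 0) (hα : α i = 0) (hβ : β i = 0) :
    biseries a α β 0 = a i := by
  rw [biseries, tsum_eq_single i]
  · simp [hα, hβ]
  · intro j hj
    by_cases h1 : α j = 0
    · by_cases h2 : β j = 0
      · simp [h j hj h1 h2]
      · simp [h2]
    · simp [h1]

/-- The expansion of a solution, with its coefficients expressed through derivatives at `0`. -/
lemma IsSolution.expansion (hu : IsSolution s t r u) : ContDiffOn ℝ ∞ u disc ∧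
    ConvDisc (fun p : ℕ × ℕ => dz^[p.1] u 0 / (p.1 ! : ℂ) * coef s t r p.1 p.2)
      (fun p => p.1 + p.2) (fun p => p.2) ∧
    ConvDisc (fun p : ℕ × ℕ => dzbar^[p.1 + 1] u 0 / ((p.1 + 1)! : ℂ) * coef t s r (p.1 + 1) p.2)
      (fun p => p.2) (fun p => p.1 + 1 + p.2) ∧
    EqOn u (fun z =>
      biseries (fun p : ℕ × ℕ => dz^[p.1] u 0 / (p.1 ! : ℂ) * coef s t r p.1 p.2)
        (fun p => p.1 + p.2) (fun p => p.2) z +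
      biseries (fun p : ℕ × ℕ =>
          dzbar^[p.1 + 1] u 0 / ((p.1 + 1)! : ℂ) * coef t s r (p.1 + 1) p.2)
        (fun p => p.2) (fun p => p.1 + 1 + p.2) z) disc := by
  obtain ⟨c, d, hC, hD, heq⟩ := hu.exists_expansion
  have h0 : (0 : ℂ) ∈ disc := mem_disc.2 (by simp)
  have hCD := hC.sumElim hD
  have heq' := heq.trans fun z hz => (biseries_sumElim hC hD hz).symm
  have hc : ∀ m : ℕ, dz^[m] u 0 / (m ! : ℂ) = c m := by
    intro m
    rw [iterate_dz_eqOn heq' m h0, hCD.iterate_dz m h0, biseries_zero_eq_single (Sum.inl (m, 0))]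
    · simp [Nat.descFactorial_self, Nat.factorial_ne_zero]
    · rintro (⟨m', k⟩ | ⟨m', k⟩) hne h1 h2
      · simp only [Sum.elim_inl] at h1 h2
        subst h2
        -- Here m' - m truncates to 0, but the falling factorial kills the term.
        have : m' < m := lt_of_le_of_ne (by omega) fun h => hne (by rw [h])
        simp [Nat.descFactorial_of_lt this]
      · simp only [Sum.elim_inr] at h2
        omega
    · simp
    · simp
  have hd : ∀ m : ℕ, dzbar^[m + 1] u 0 / ((m + 1)! : ℂ) = d (m + 1) := by
    intro m
    rw [iterate_dzbar_eqOn heq' (m + 1) h0, hCD.iterate_dzbar (m + 1) h0,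
      biseries_zero_eq_single (Sum.inr (m, 0))]
    · simp only [Sum.elim_inr, add_zero, Nat.descFactorial_self, coef_zero, mul_one]
      exact mul_div_cancel_left₀ _ (by exact_mod_cast (m + 1).factorial_ne_zero)
    · rintro (⟨m', k⟩ | ⟨m', k⟩) hne h1 h2
      · simp only [Sum.elim_inl] at h1 h2
        have : k < m + 1 := by omega
        simp only [Sum.elim_inl, Nat.descFactorial_of_lt this, Nat.cast_zero, zero_mul]
      · simp only [Sum.elim_inr] at h1 h2
        subst h1
        have : m' + 1 < m + 1 := lt_of_le_of_ne (by omega) fun h => hne (by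
          rw [Nat.succ_injective h])
        simp only [Sum.elim_inr, add_zero, Nat.descFactorial_of_lt this, Nat.cast_zero, zero_mul]
    · simp
    · simp
  simp only [hc, hd]
  exact ⟨hCD.contDiffOn.congr heq', hC, hD, heq⟩

lemma holTerm_eq (s t r : ℂ) (u : ℂ → ℂ) (m : ℕ) (z : ℂ) : holTerm s t r u m z =
    biseries (fun k => dz^[m] u 0 / (m ! : ℂ) * coef s t r m k) (fun k => m + k)
      (fun k => k) z := by
  rw [biseries_const_mul, ← P_mul_pow, holTerm, mul_assoc]

lemma antiholTerm_eq (s t r : ℂ) (u : ℂ → ℂ) (m : ℕ) (z : ℂ) : antiholTerm s t r u m z =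
    biseries (fun k => dzbar^[m] u 0 / (m ! : ℂ) * coef t s r m k) (fun k => k)
      (fun k => m + k) z := by
  rw [biseries_const_mul, ← P_mul_conj_pow, antiholTerm, mul_assoc]

/-! ### The Helmholtz and Laplace equations -/

lemma poch_mul_factorial (m k : ℕ) : poch (m + 1) 1 k * (m ! : ℂ) = ((m + k)! : ℂ) := by
  induction k with
  | zero => simp [poch]
  | succ k ih =>
    rw [poch_succ, mul_right_comm, ih, ← add_assoc, Nat.factorial_succ]
    push_cast
    ring

lemma coef_helmholtz (r : ℂ) (m k : ℕ) :
    coef 0 0 r m k = (m ! : ℂ) / ((m + k)! : ℂ) * (r ^ k / (k ! : ℂ)) := by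
  have hm : (m ! : ℂ) ≠ 0 := by exact_mod_cast m.factorial_ne_zero
  have hr : poch (r + 0 * m) (0 + 0) k = r ^ k := by simp [poch]
  rw [coef, hr, ← poch_mul_factorial]
  field_simp

lemma IsSolution.helmholtz (hu : IsSolution 0 0 r u) {z : ℂ} (hz : z ∈ disc) :
    Summable (fun p : ℕ × ℕ =>
      (z ^ (p.1 + 1) * dz^[p.1 + 1] u 0 + (conj z) ^ (p.1 + 1) * dzbar^[p.1 + 1] u 0)
        / ((p.1 + 1 + p.2)! : ℂ) * (r ^ p.2 * (‖z‖ : ℂ) ^ (2 * p.2) / (p.2 ! : ℂ))) ∧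
    Summable (fun n : ℕ =>
      u 0 / (n ! : ℂ) * (r ^ n * (‖z‖ : ℂ) ^ (2 * n) / (n ! : ℂ))) ∧
    u z = (∑' m : ℕ, ∑' n : ℕ,
        (z ^ (m + 1) * dz^[m + 1] u 0 + (conj z) ^ (m + 1) * dzbar^[m + 1] u 0)
          / ((m + 1 + n)! : ℂ) * (r ^ n * (‖z‖ : ℂ) ^ (2 * n) / (n ! : ℂ)))
      + ∑' n : ℕ, u 0 / (n ! : ℂ) * (r ^ n * (‖z‖ : ℂ) ^ (2 * n) / (n ! : ℂ)) := by
  obtain ⟨-, hC, hD, heq⟩ := hu.expansion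
  have hsC := hC.summable hz
  have hsD := hD.summable hz
  have hfac : ∀ n : ℕ, (n ! : ℂ) ≠ 0 := fun n => by exact_mod_cast n.factorial_ne_zero
  have hnorm : ∀ n : ℕ, (‖z‖ : ℂ) ^ (2 * n) = z ^ n * conj z ^ n := fun n => by
    rw [pow_mul, ← Complex.mul_conj', mul_pow]
  -- Row m = 0 is set aside: it gives the single series in u(0), and the other rows pair with the
  -- antiholomorphic terms.
  have hsC' := hsC.comp_injective (i := fun p : ℕ × ℕ => (p.1 + 1, p.2)) fun p q h => by
    simpa [Prod.ext_iff] using h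
  have hterm : ∀ p : ℕ × ℕ,
      dz^[p.1 + 1] u 0 / ((p.1 + 1)! : ℂ) * coef 0 0 r (p.1 + 1) p.2 * z ^ (p.1 + 1 + p.2) *
          conj z ^ p.2 +
        dzbar^[p.1 + 1] u 0 / ((p.1 + 1)! : ℂ) * coef 0 0 r (p.1 + 1) p.2 * z ^ p.2 *
          conj z ^ (p.1 + 1 + p.2) =
      (z ^ (p.1 + 1) * dz^[p.1 + 1] u 0 + (conj z) ^ (p.1 + 1) * dzbar^[p.1 + 1] u 0)
        / ((p.1 + 1 + p.2)! : ℂ) * (r ^ p.2 * (‖z‖ : ℂ) ^ (2 * p.2) / (p.2 ! : ℂ)) := by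
    intro p
    have h1 := hfac (p.1 + 1)
    have h2 := hfac (p.1 + 1 + p.2)
    have h3 := hfac p.2
    rw [coef_helmholtz, hnorm, pow_add z (p.1 + 1), pow_add (conj z) (p.1 + 1)]
    field_simp
  have hterm0 : ∀ n : ℕ, dz^[0] u 0 / (0 ! : ℂ) * coef 0 0 r 0 n * z ^ (0 + n) * conj z ^ n =
      u 0 / (n ! : ℂ) * (r ^ n * (‖z‖ : ℂ) ^ (2 * n) / (n ! : ℂ)) := by
    intro n
    rw [coef_helmholtz, hnorm, zero_add]
    simp
    ring
  have hsum := hsC'.add hsD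
  have hsumm : Summable fun n : ℕ => _ := hsC.prod_factor 0
  refine ⟨hsum.congr hterm, hsumm.congr hterm0, ?_⟩
  have hhol : biseries (fun p : ℕ × ℕ => dz^[p.1] u 0 / (p.1 ! : ℂ) * coef 0 0 r p.1 p.2)
      (fun p => p.1 + p.2) (fun p => p.2) z =
      (∑' n : ℕ, u 0 / (n ! : ℂ) * (r ^ n * (‖z‖ : ℂ) ^ (2 * n) / (n ! : ℂ))) +
        ∑' p : ℕ × ℕ, dz^[p.1 + 1] u 0 / ((p.1 + 1)! : ℂ) * coef 0 0 r (p.1 + 1) p.2 *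
          z ^ (p.1 + 1 + p.2) * conj z ^ p.2 := by
    rw [biseries, hsC.tsum_prod, hsC.prod.tsum_eq_zero_add, ← tsum_congr hterm0]
    exact congrArg _ hsC'.tsum_prod.symm
  have hdouble := hsum.tsum_prod.trans (tsum_congr fun m => tsum_congr fun n => hterm (m, n))
  rw [heq hz, ← hdouble, hsC'.tsum_add hsD]
  dsimp only
  rw [hhol]
  simp only [biseries, Function.comp_def]
  ring

lemma IsSolution.laplace (hu : IsSolution 0 0 0 u) {z : ℂ} (hz : z ∈ disc) :
    Summable (fun m : ℕ =>
      (z ^ (m + 1) * dz^[m + 1] u 0 + (conj z) ^ (m + 1) * dzbar^[m + 1] u 0) / ((m + 1)! : ℂ)) ∧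
    u z = (∑' m : ℕ,
        (z ^ (m + 1) * dz^[m + 1] u 0 + (conj z) ^ (m + 1) * dzbar^[m + 1] u 0)
          / ((m + 1)! : ℂ)) + u 0 := by
  obtain ⟨h1, -, h3⟩ := hu.helmholtz hz
  refine ⟨?_, ?_⟩
  · have := h1.comp_injective (i := fun m : ℕ => (m, 0)) fun m n h => (Prod.ext_iff.1 h).1
    simpa [Function.comp_def] using this
  -- With r = 0 only n = 0 survives, because `0 ^ 0 = 1`; `q` lets one identity serve both series.
  · have hsingle : ∀ (A : ℂ) (q : ℕ → ℕ), (∑' n : ℕ, A / ((q n)! : ℂ) *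
        (0 ^ n * (‖z‖ : ℂ) ^ (2 * n) / (n ! : ℂ))) = A / ((q 0)! : ℂ) := by
      intro A q
      rw [tsum_eq_single 0 fun n hn => by simp [hn]]
      simp
    rw [h3, hsingle _ fun n => n]
    simp only [hsingle _ fun n => _ + 1 + n]
    simp

end GenHarmonic
end

open GenHarmonic in
theorem mainTheorem2 (s t r : ℂ) (u : ℂ → ℂ) (hu : IsSolution s t r u) :
    -- `u` is smooth, so that all its derivatives at the origin exist
    ContDiffOn ℝ ∞ u disc ∧
    -- the expansion converges absolutely in `C^∞` of the disc
    (∀ (j k : ℕ) (K : Set ℂ), IsCompact K → K ⊆ disc →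
      Summable (fun m : ℕ => seminormOn j k K (holTerm s t r u m)) ∧
      Summable (fun m : ℕ => seminormOn j k K (antiholTerm s t r u (m + 1)))) ∧
    -- and its sum is `u`
    (∀ z ∈ disc,
      Summable (fun m : ℕ => ‖holTerm s t r u m z‖) ∧
      Summable (fun m : ℕ => ‖antiholTerm s t r u (m + 1) z‖) ∧
      u z = (∑' m : ℕ, holTerm s t r u m z) + (∑' m : ℕ, antiholTerm s t r u (m + 1) z)) ∧
    -- the Helmholtz equation `∂∂̄u - r u = 0`
    (s = 0 → t = 0 → ∀ z ∈ disc,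
      Summable (fun p : ℕ × ℕ =>
        (z ^ (p.1 + 1) * dz^[p.1 + 1] u 0 + (conj z) ^ (p.1 + 1) * dzbar^[p.1 + 1] u 0)
          / ((p.1 + 1 + p.2)! : ℂ) * (r ^ p.2 * (‖z‖ : ℂ) ^ (2 * p.2) / (p.2 ! : ℂ))) ∧
      Summable (fun n : ℕ =>
        u 0 / (n ! : ℂ) * (r ^ n * (‖z‖ : ℂ) ^ (2 * n) / (n ! : ℂ))) ∧
      u z = (∑' m : ℕ, ∑' n : ℕ,
          (z ^ (m + 1) * dz^[m + 1] u 0 + (conj z) ^ (m + 1) * dzbar^[m + 1] u 0)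
            / ((m + 1 + n)! : ℂ) * (r ^ n * (‖z‖ : ℂ) ^ (2 * n) / (n ! : ℂ)))
        + ∑' n : ℕ, u 0 / (n ! : ℂ) * (r ^ n * (‖z‖ : ℂ) ^ (2 * n) / (n ! : ℂ))) ∧
    -- the Laplace equation `∂∂̄u = 0`
    (s = 0 → t = 0 → r = 0 → ∀ z ∈ disc,
      Summable (fun m : ℕ =>
        (z ^ (m + 1) * dz^[m + 1] u 0 + (conj z) ^ (m + 1) * dzbar^[m + 1] u 0)
          / ((m + 1)! : ℂ)) ∧
      u z = (∑' m : ℕ,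
          (z ^ (m + 1) * dz^[m + 1] u 0 + (conj z) ^ (m + 1) * dzbar^[m + 1] u 0)
            / ((m + 1)! : ℂ))
        + u 0) := by
  obtain ⟨hsmooth, hC, hD, heq⟩ := hu.expansion
  refine ⟨hsmooth, fun j k K hK hKd => ⟨?_, ?_⟩, fun z hz => ?_, ?_, ?_⟩
  · exact hC.summable_seminormOn (fun m z _ => holTerm_eq s t r u m z) hK hKd j k
  · exact hD.summable_seminormOn (fun m z _ => antiholTerm_eq s t r u (m + 1) z) hK hKd j k
  · have h1 := hC.hasSum_grouped hz
    have h2 := hD.hasSum_grouped hz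
    simp only [← holTerm_eq] at h1
    simp only [← antiholTerm_eq] at h2
    exact ⟨h1.summable.norm, h2.summable.norm, by rw [h1.tsum_eq, h2.tsum_eq]; exact heq hz⟩
  · rintro rfl rfl z hz
    exact hu.helmholtz hz
  · rintro rfl rfl rfl z hz
    exact hu.laplace hz
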